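/- Let $K$ be an algebraically closed field of characteristic $0$, let $n \geq 2$, and let $\Gamma \subset \mathbb{P}^n = \mathbb{P}^n_K$ be a finite subscheme with ideal sheaf $\mathcal{I}_\Gamma$, of degree (that is, length) $d = h^0(\Gamma, \mathcal{O}_\Gamma) \geq 4n^2+6n+1$. Assume that $\Gamma$ is in linearly general position, i.e. the smallest integer $t \ge 0$ for which there is a $t$-dimensional linear subspace $\Lambda \subset \mathbb{P}^n$ such that the scheme-theoretic intersection $\Gamma \cap \Lambda$ has length at least $t+2$ is $t = n$. Write $d = nq+r+2$ with integers $q$ and $0 \leq r \leq n-1$. Then $$h^1(\mathbb{P}^n, \mathcal{I}_\Gamma(q)) \leq r+1.$$ Moreover, the following two statements are equivalent: (i) $\Gamma$ is contained (as a subscheme) in a rational normal curve of degree $n$ in $\mathbb{P}^n$; (ii) $h^1(\mathbb{P}^n, \mathcal{I}_\Gamma(q)) = r+1$. If, in addition, $\Gamma$ is a finite set of points (i.e. reduced) and $h^1(\mathbb{P}^n, \mathcal{I}_\Gamma(q)) > 0$, then the following two statements are equivalent: (i) $\Gamma$ is in uniform position, i.e. $\Gamma$ lies in no hyperplane and, with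 $h_Z(\ell)$ denoting the Hilbert function of a finite set $Z \subset \mathbb{P}^n$, one has $h_Y(\ell) = \min\{|Y|, h_\Gamma(\ell)\}$ for every subset $Y \subseteq \Gamma$ and every integer $\ell \geq 0$; (ii) $h^1(\mathbb{P}^n, \mathcal{I}_\Gamma(q)) = r+1$. -/

import Mathlib

open MvPolynomial
open scoped LinearAlgebra.Projectivization

noncomputable section

namespace ProjSpace

/-- The homogeneous coordinate ring `K[x₀, …, xₙ]` of `ℙⁿ`. -/
abbrev CoordRing (K : Type*) [Field K] (n : ℕ) : Type _ := MvPolynomial (Fin (n + 1)) K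

/-- The field of fractions of the homogeneous coordinate ring; all sections of the sheaves
`𝓘(q) ⊆ 𝓞(q)` over the open sets `D₊(x^a)` are elements of it. -/
abbrev Frac (K : Type*) [Field K] (n : ℕ) : Type _ := FractionRing (CoordRing K n)

variable {K : Type*} [Field K] {n : ℕ}

/-- For an ideal `J` of the coordinate ring with associated ideal sheaf `𝓙` on `ℙⁿ`, the space
`H⁰(D₊(x^a), 𝓙(q))`, i.e. the degree `q` part of the localization of `J` at the monomial `x^a`:
the fractions `f / (x^a)^k` with `f ∈ J` homogeneous of degree `q + k * |a|`. -/
def sections (J : Ideal (CoordRing K n)) (q : ℕ) (a : Fin (n + 1) →₀ ℕ) :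
    Submodule K (Frac K n) where
  carrier := {z | ∃ k : ℕ, ∃ f ∈ J, f.IsHomogeneous (q + k * a.degree) ∧
    z * algebraMap (CoordRing K n) (Frac K n) (monomial a 1 ^ k) =
      algebraMap (CoordRing K n) (Frac K n) f}
  zero_mem' := ⟨0, 0, J.zero_mem, isHomogeneous_zero _ _ _, by simp⟩
  add_mem' := by
    rintro y z ⟨k, f, hf, hfh, hy⟩ ⟨l, g, hg, hgh, hz⟩
    have hm : ∀ m : ℕ, (monomial a (1 : K) ^ m).IsHomogeneous (a.degree * m) := fun m =>
      (isHomogeneous_monomial (1 : K) rfl).pow m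
    refine ⟨k + l, f * monomial a 1 ^ l + g * monomial a 1 ^ k,
      J.add_mem (J.mul_mem_right _ hf) (J.mul_mem_right _ hg), ?_, ?_⟩
    · refine IsHomogeneous.add ?_ ?_
      · have h := hfh.mul (hm l)
        rwa [show q + k * a.degree + a.degree * l = q + (k + l) * a.degree by ring] at h
      · have h := hgh.mul (hm k)
        rwa [show q + l * a.degree + a.degree * k = q + (k + l) * a.degree by ring] at h
    · rw [map_add, map_mul, map_mul, ← hy, ← hz, pow_add, map_mul]
      ring
  smul_mem' := by
    rintro c z ⟨k, f, hf, hfh, hz⟩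
    refine ⟨k, c • f, ?_, ?_, ?_⟩
    · rw [smul_eq_C_mul]
      exact J.mul_mem_left _ hf
    · exact (homogeneousSubmodule (Fin (n + 1)) K _).smul_mem c hfh
    · rw [smul_mul_assoc, hz, Algebra.algebraMap_eq_smul_one, Algebra.algebraMap_eq_smul_one,
        smul_assoc]

/-- The exponent of `x_i`; its open set is `D₊(x_i)`. -/
abbrev chart (i : Fin (n + 1)) : Fin (n + 1) →₀ ℕ := Finsupp.single i 1

/-- The exponent of `x_i x_j`; its open set is `D₊(x_i) ∩ D₊(x_j)`. -/
abbrev overlap (i j : Fin (n + 1)) : Fin (n + 1) →₀ ℕ := chart i + chart j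

/-- Lifts of global sections of `𝓞/𝓙`: families of functions `s_i` on `D₊(x_i)` that agree modulo
`𝓙` on the overlaps. -/
def quotientCocycles (J : Ideal (CoordRing K n)) : Submodule K (Fin (n + 1) → Frac K n) where
  carrier := {s | (∀ i, s i ∈ sections ⊤ 0 (chart i)) ∧
    ∀ i j, s j - s i ∈ sections J 0 (overlap i j)}
  zero_mem' := ⟨fun _ => Submodule.zero_mem _, fun _ _ => by simp⟩
  add_mem' := by
    rintro s t ⟨hs, hs'⟩ ⟨ht, ht'⟩
    refine ⟨fun i => Submodule.add_mem _ (hs i) (ht i), fun i j => ?_⟩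
    have h := Submodule.add_mem _ (hs' i j) (ht' i j)
    rwa [show s j - s i + (t j - t i) = (s + t) j - (s + t) i by simp; ring] at h
  smul_mem' := by
    rintro c s ⟨hs, hs'⟩
    refine ⟨fun i => Submodule.smul_mem _ c (hs i), fun i j => ?_⟩
    have h := Submodule.smul_mem _ c (hs' i j)
    rwa [smul_sub] at h

/-- Families of sections of `𝓙` over the `D₊(x_i)`. -/
def quotientTrivial (J : Ideal (CoordRing K n)) : Submodule K (Fin (n + 1) → Frac K n) :=
  Submodule.pi Set.univ fun i => sections J 0 (chart i)

/-- The space `H⁰(ℙⁿ, 𝓞/𝓙)`: global sections of the structure sheaf of the closed subscheme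
defined by the ideal sheaf `𝓙` of `J`, glued from the affine charts. -/
abbrev StructureSections (J : Ideal (CoordRing K n)) : Type _ :=
  quotientCocycles J ⧸ (quotientTrivial J).submoduleOf (quotientCocycles J)

/-- The length `h⁰(𝓞/𝓙)` of the (finite) subscheme of `ℙⁿ` defined by the ideal sheaf of `J`. -/
def length (J : Ideal (CoordRing K n)) : ℕ∞ := Module.length K (StructureSections J)

/-- Čech 1-cocycles of `𝓙(q)` for the cover of `ℙⁿ` by the `D₊(x_i)`. -/
def cocycles (J : Ideal (CoordRing K n)) (q : ℕ) :
    Submodule K (Fin (n + 1) → Fin (n + 1) → Frac K n) where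
  carrier := {c | (∀ i j, c i j ∈ sections J q (overlap i j)) ∧
    ∀ i j k, c i j + c j k = c i k}
  zero_mem' := ⟨fun _ _ => Submodule.zero_mem _, fun _ _ _ => by simp⟩
  add_mem' := by
    rintro s t ⟨hs, hs'⟩ ⟨ht, ht'⟩
    refine ⟨fun i j => Submodule.add_mem _ (hs i j) (ht i j), fun i j k => ?_⟩
    simp only [Pi.add_apply, ← hs' i j k, ← ht' i j k]
    ring
  smul_mem' := by
    rintro c s ⟨hs, hs'⟩
    refine ⟨fun i j => Submodule.smul_mem _ c (hs i j), fun i j k => ?_⟩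
    simp only [Pi.smul_apply, ← hs' i j k, smul_add]

/-- Čech 1-coboundaries of `𝓙(q)` for the cover of `ℙⁿ` by the `D₊(x_i)`. -/
def coboundaries (J : Ideal (CoordRing K n)) (q : ℕ) :
    Submodule K (Fin (n + 1) → Fin (n + 1) → Frac K n) where
  carrier := {c | ∃ b : Fin (n + 1) → Frac K n,
    (∀ i, b i ∈ sections J q (chart i)) ∧ ∀ i j, c i j = b j - b i}
  zero_mem' := ⟨0, fun _ => Submodule.zero_mem _, fun _ _ => by simp⟩
  add_mem' := by
    rintro s t ⟨b, hb, hs⟩ ⟨b', hb', ht⟩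
    refine ⟨b + b', fun i => Submodule.add_mem _ (hb i) (hb' i), fun i j => ?_⟩
    simp only [Pi.add_apply, hs, ht]
    ring
  smul_mem' := by
    rintro c s ⟨b, hb, hs⟩
    refine ⟨c • b, fun i => Submodule.smul_mem _ c (hb i), fun i j => ?_⟩
    simp only [Pi.smul_apply, hs, smul_sub]

/-- The first cohomology `H¹(ℙⁿ, 𝓙(q))`, as Čech cohomology of the standard affine cover. -/
abbrev H1 (J : Ideal (CoordRing K n)) (q : ℕ) : Type _ :=
  cocycles J q ⧸ (coboundaries J q).submoduleOf (cocycles J q)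

/-- The dimension `h¹(ℙⁿ, 𝓙(q))`, with value `⊤` if it is infinite. -/
def h1 (J : Ideal (CoordRing K n)) (q : ℕ) : ℕ∞ := Module.length K (H1 J q)

/-- The Hilbert function of the ideal `J`: the dimension of the degree `ℓ` part of
`K[x₀, …, xₙ] / J`, i.e. of the image of the forms of degree `ℓ`. -/
def hilbertFunction (J : Ideal (CoordRing K n)) (ℓ : ℕ) : ℕ :=
  Module.finrank K
    ((homogeneousSubmodule (Fin (n + 1)) K ℓ).map (Ideal.Quotient.mkₐ K J).toLinearMap)

/-- A closed subscheme of `ℙⁿ`, given by its saturated homogeneous ideal. -/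
structure ClosedSubscheme (K : Type*) [Field K] (n : ℕ) where
  /-- The saturated homogeneous ideal of the subscheme. -/
  ideal : Ideal (CoordRing K n)
  homogeneous : ∀ f ∈ ideal, ∀ m : ℕ, homogeneousComponent m f ∈ ideal
  saturated : ∀ f : CoordRing K n, (∀ i, ∃ m : ℕ, X i ^ m * f ∈ ideal) → f ∈ ideal

namespace ClosedSubscheme

/-- Scheme-theoretic inclusion of closed subschemes. -/
instance : LE (ClosedSubscheme K n) := ⟨fun Γ C => C.ideal ≤ Γ.ideal⟩

/-- A closed subscheme is finite (over `K`) if the coordinate ring of each affine chart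
`Γ ∩ D₊(x_i)` is a finite-dimensional vector space. -/
def IsFinite (Γ : ClosedSubscheme K n) : Prop :=
  ∀ i : Fin (n + 1), Module.Finite K
    (sections (⊤ : Ideal (CoordRing K n)) 0 (chart i) ⧸
      (sections Γ.ideal 0 (chart i)).submoduleOf (sections ⊤ 0 (chart i)))

/-- The degree (length) of a finite subscheme. -/
def degree (Γ : ClosedSubscheme K n) : ℕ∞ := length Γ.ideal

/-- `Γ` admits a `(t + 2)`-secant `t`-plane: a `t`-dimensional linear subspace `Λ` of `ℙⁿ`, cut out
by an `(n - t)`-dimensional space `L` of linear forms, such that the scheme `Γ ∩ Λ` with ideal sheaf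
`𝓘_Γ + 𝓘_Λ` has length at least `t + 2`. -/
def HasSecantPlane (Γ : ClosedSubscheme K n) (t : ℕ) : Prop :=
  ∃ L : Submodule K (CoordRing K n), L ≤ homogeneousSubmodule (Fin (n + 1)) K 1 ∧
    Module.finrank K L + t = n ∧
    ((t + 2 : ℕ) : ℕ∞) ≤ length (Γ.ideal ⊔ Ideal.span (L : Set (CoordRing K n)))

/-- A finite subscheme of `ℙⁿ` is in linearly general position if the smallest `t` for which it
admits a `(t + 2)`-secant `t`-plane is `n`. -/
def IsInLinearlyGeneralPosition (Γ : ClosedSubscheme K n) : Prop :=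
  IsLeast {t : ℕ | Γ.HasSecantPlane t} n

/-- `C` is a rational normal curve (of degree `n`) in `ℙⁿ`: the image of `ℙ¹` under the map
`[F₀ : … : Fₙ]` given by a basis `F₀, …, Fₙ` of the binary forms of degree `n`, with its reduced
structure; its ideal consists of the polynomials that vanish on substituting the `F_i`. -/
def IsRationalNormalCurve (C : ClosedSubscheme K n) : Prop :=
  ∃ F : Fin (n + 1) → MvPolynomial (Fin 2) K, (∀ i, (F i).IsHomogeneous n) ∧
    LinearIndependent K F ∧ C.ideal = RingHom.ker (aeval F : CoordRing K n →ₐ[K] _)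

/-- `Γ` is (scheme-theoretically) contained in some rational normal curve of `ℙⁿ`. -/
def LiesOnRationalNormalCurve (Γ : ClosedSubscheme K n) : Prop :=
  ∃ C : ClosedSubscheme K n, C.IsRationalNormalCurve ∧ Γ ≤ C

end ClosedSubscheme

/-- The homogeneous ideal of a finite set of points of `ℙⁿ` (for infinite `K`): the polynomials
that vanish on the union of the lines in `Kⁿ⁺¹` corresponding to the points. -/
def pointsIdeal (Y : Finset (ℙ K (Fin (n + 1) → K))) : Ideal (CoordRing K n) :=
  vanishingIdeal K (⋃ p ∈ Y, (p.submodule : Set (Fin (n + 1) → K)))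

/-- A finite set of points of `ℙⁿ` is in uniform position if it is nondegenerate (lies in no
hyperplane) and every subset `Y` has Hilbert function `min (|Y|, h_S)`. -/
def IsInUniformPosition (S : Finset (ℙ K (Fin (n + 1) → K))) : Prop :=
  (∀ f ∈ pointsIdeal S, f.IsHomogeneous 1 → f = 0) ∧
    ∀ Y ⊆ S, ∀ ℓ : ℕ,
      hilbertFunction (pointsIdeal Y) ℓ = min Y.card (hilbertFunction (pointsIdeal S) ℓ)

end ProjSpace

end

/-! A hyperplane `l = 0` that misses `Γ` turns the problem into one about a finite algebra. The
coordinate ring `A` of the affine piece `l = 1` has dimension `d`, the linear forms restrict to a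
subspace `V` of dimension `n + 1` containing `1`, and the forms of degree `k` restrict to `V ^ k`. A
Čech computation, resting on `H¹(ℙⁿ, 𝓞(q)) = 0`, gives `h¹(𝓘_Γ(q)) = dim A / V ^ q`, and saturation
gives `h_Γ(k) = dim V ^ k`. Linearly general position becomes `IsLinearlyGeneral`: `c ≥ 1`
independent elements of `V` generate an ideal of colength at most `n + 1 - c`.

Castelnuovo's bound `dim V ^ k ≥ min (d, n * k + 1)` (`min_le_finrank_pow_sup`) comes from peeling
off subschemes of length `n` by hyperplanes. For `k = q` it says `h¹ ≤ d - (n * q + 1) = r + 1`. On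
a rational normal curve forms of degree `k` restrict to binary forms of degree `n * k`, so there the
bound is attained.

Conversely, `dim V ^ q = n * q + 1` forces a curve by Castelnuovo's lemma
(`exists_basis_minors_eq_zero`). A subscheme of length `n * q + 2` carries a functional that kills
`V ^ q` and induces a perfect pairing on its coordinate ring; playing `V ^ 2` against `V ^ (q - 2)`
shows `dim V ^ 2 ≤ 2 * n + 1`. A pencil `s, t` of hyperplanes through a subscheme of length `n - 1`
then has so many syzygies `s * g = t * f` with `f, g ∈ V` that Kronecker's normal form of pencils
yields a basis `u₀, …, uₙ` of `V` for which the `2 × 2` minors of the matrix with columns `(uᵢ,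
uᵢ₊₁)` vanish. These are the equations of a rational normal curve, and `aeval_eq_zero_of_minors`
turns them into scheme-theoretic containment.

For points in uniform position the Hilbert function is superadditive (`min_le_hilbertFunction_add`).
If `h(3)` exceeded `3 * n + 1`, the excess would accumulate until `h(q) = d`, that is `h¹ = 0`. So
`h(3) = 3 * n + 1`, and Castelnuovo's lemma applies in degree 3. Conversely, on a rational normal
curve in this situation every subset `Y` has Hilbert function `min (|Y|, n * k + 1)`, which is
uniform position. -/

noncomputable section

namespace ProjSpace

open Module

/-! ### Finite algebras in linearly general position and Castelnuovo's bound. -/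

section LinearlyGeneralPosition

variable {K A : Type*} [Field K] [CommRing A] [Algebra K A]

/-- A space `V` of functions on a finite scheme `Spec A`, containing the constants, embeds the
scheme in `ℙⁿ` in linearly general position. -/
structure IsLinearlyGeneral (n : ℕ) (V : Submodule K A) : Prop where
  one_mem : 1 ∈ V
  finrank_eq : finrank K V = n + 1
  finrank_quotient_add_le : ∀ W ≤ V, W ≠ ⊥ →
    finrank K (A ⧸ Ideal.span (W : Set A)) + finrank K W ≤ n + 1

theorem finrank_quotient_add_finrank_restrictScalars [Module.Finite K A] (I : Ideal A) :
    finrank K (A ⧸ I) + finrank K (I.restrictScalars K) = finrank K A := by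
  rw [← (Submodule.Quotient.restrictScalarsEquiv K I).finrank_eq]
  exact Submodule.finrank_quotient_add_finrank _

theorem finrank_map_add_finrank_inf_ker {M M' : Type*} [AddCommGroup M] [Module K M]
    [AddCommGroup M'] [Module K M'] (f : M →ₗ[K] M') (U : Submodule K M) [Module.Finite K U] :
    finrank K (U.map f) + finrank K (U ⊓ LinearMap.ker f : Submodule K M) = finrank K U := by
  have h := LinearMap.finrank_range_add_finrank_ker (f.domRestrict U)
  rw [LinearMap.range_domRestrict, LinearMap.ker_domRestrict] at h
  rw [← h, ← Submodule.map_comap_subtype,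
    (Submodule.equivMapOfInjective U.subtype U.injective_subtype _).finrank_eq.symm]

theorem finrank_submodule_prod {M M' : Type*} [AddCommGroup M] [Module K M] [AddCommGroup M']
    [Module K M'] (U : Submodule K M) (W : Submodule K M') [Module.Finite K U]
    [Module.Finite K W] : finrank K (U.prod W) = finrank K U + finrank K W := by
  have h : U.prod W = LinearMap.range (U.subtype.prodMap W.subtype) := by
    rw [LinearMap.range_prodMap, Submodule.range_subtype, Submodule.range_subtype]
  rw [h, LinearMap.finrank_range_of_inj
    (Function.Injective.prodMap U.injective_subtype W.injective_subtype), finrank_prod]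

theorem pow_le_pow_of_one_mem {V : Submodule K A} (h : 1 ∈ V) {a b : ℕ} (hab : a ≤ b) :
    V ^ a ≤ V ^ b := by
  obtain ⟨c, rfl⟩ := Nat.exists_eq_add_of_le hab
  rw [pow_add]
  intro x hx
  have h1 : (1 : A) ∈ V ^ c := by simpa using Submodule.pow_mem_pow V h c
  simpa using Submodule.mul_mem_mul hx h1

/-- Over an algebraically closed field every proper ideal of a finite algebra is contained in an
ideal of dimension one more. -/
theorem exists_ideal_finrank_eq_add_one [IsAlgClosed K] [Module.Finite K A] (I : Ideal A)
    (hI : I ≠ ⊤) :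
    ∃ J : Ideal A, I ≤ J ∧
      finrank K (J.restrictScalars K) = finrank K (I.restrictScalars K) + 1 := by
  have : IsNoetherianRing A := isNoetherian_of_tower K inferInstance
  have : Nontrivial (A ⧸ I) := Ideal.Quotient.nontrivial_iff.mpr hI
  -- `P` is the annihilator of a class `x` modulo `I`, and `A ⧸ P = K` because `K` is algebraically
  -- closed. Hence `I + K x` is already an ideal.
  obtain ⟨P, hP⟩ := associatedPrimes.nonempty A (A ⧸ I)
  obtain ⟨hPp, y, hy⟩ := isAssociatedPrime_iff.mp hP
  obtain ⟨x, rfl⟩ := Ideal.Quotient.mk_surjective y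
  have hann : ∀ a : A, a ∈ P → a * x ∈ I := by
    intro a ha
    rw [hy, Submodule.mem_colon_singleton, Submodule.mem_bot] at ha
    exact Ideal.Quotient.eq_zero_iff_mem.mp ha
  have hxI : x ∉ I := by
    intro hx
    refine hPp.ne_top ((Ideal.eq_top_iff_one _).mpr ?_)
    rw [hy, Submodule.mem_colon_singleton, one_smul, Submodule.mem_bot]
    exact Ideal.Quotient.eq_zero_iff_mem.mpr hx
  have hx0 : x ≠ 0 := by
    rintro rfl
    exact hxI I.zero_mem
  have hc : ∀ a : A, ∃ c : K, a - algebraMap K A c ∈ P := by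
    intro a
    obtain ⟨c, hc⟩ := (IsAlgClosed.algebraMap_bijective_of_isIntegral
      (k := K) (K := A ⧸ P)).2 (Ideal.Quotient.mk P a)
    refine ⟨c, ?_⟩
    rw [← Ideal.Quotient.eq, ← hc]
    rfl
  have hsm : ∀ z ∈ I.restrictScalars K ⊔ K ∙ x, ∀ a : A,
      a * z ∈ I.restrictScalars K ⊔ K ∙ x := by
    intro z hz a
    obtain ⟨i, hi, w, hw, rfl⟩ := Submodule.mem_sup.mp hz
    obtain ⟨e, rfl⟩ := Submodule.mem_span_singleton.mp hw
    obtain ⟨c, hc⟩ := hc a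
    rw [show a * (i + e • x) = (a * i + e • ((a - algebraMap K A c) * x)) + (e * c) • x by
      simp only [Algebra.smul_def, map_mul]; ring]
    refine Submodule.add_mem_sup (I.restrictScalars K |>.add_mem (I.mul_mem_left _ hi) ?_)
      (Submodule.smul_mem _ _ (Submodule.mem_span_singleton_self x))
    exact (I.restrictScalars K).smul_mem e (hann _ hc)
  let J : Ideal A :=
    { (I.restrictScalars K ⊔ K ∙ x).toAddSubmonoid with
      smul_mem' := fun a z hz => hsm z hz a }
  have hJ : J.restrictScalars K = I.restrictScalars K ⊔ K ∙ x := rfl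
  refine ⟨J, fun z hz => (le_sup_left : I.restrictScalars K ≤ _) hz, ?_⟩
  have h0 : I.restrictScalars K ⊓ K ∙ x = ⊥ := by
    rw [eq_bot_iff]
    rintro z ⟨hz, hz'⟩
    obtain ⟨e, rfl⟩ := Submodule.mem_span_singleton.mp hz'
    by_cases he : e = 0
    · simp [he]
    · exact absurd ((Submodule.smul_mem_iff (I.restrictScalars K) he).mp hz) hxI
  have := Submodule.finrank_sup_add_finrank_inf_eq (I.restrictScalars K) (K ∙ x)
  rw [h0, finrank_bot, finrank_span_singleton hx0, ← hJ] at this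
  exact this

theorem exists_ideal_finrank_eq [IsAlgClosed K] [Module.Finite K A] (I : Ideal A) {m : ℕ}
    (h₁ : finrank K (I.restrictScalars K) ≤ m) (h₂ : m ≤ finrank K A) :
    ∃ J : Ideal A, I ≤ J ∧ finrank K (J.restrictScalars K) = m := by
  induction m, h₁ using Nat.le_induction with
  | base => exact ⟨I, le_rfl, rfl⟩
  | succ m hm ih =>
    obtain ⟨J, hIJ, hJ⟩ := ih (by omega)
    have hJt : J ≠ ⊤ := by
      rintro rfl
      have : finrank K ((⊤ : Ideal A).restrictScalars K) = finrank K A := by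
        rw [Submodule.restrictScalars_top, finrank_top]
      omega
    obtain ⟨J', h, h'⟩ := exists_ideal_finrank_eq_add_one (K := K) J hJt
    exact ⟨J', hIJ.trans h, by omega⟩

namespace IsLinearlyGeneral

variable [Module.Finite K A] {n : ℕ} {V : Submodule K A}

theorem finrank_le_finrank_span (hV : IsLinearlyGeneral n V) {W : Submodule K A} (hW : W ≤ V)
    (hW0 : W ≠ ⊥) :
    finrank K A + finrank K W ≤
      n + 1 + finrank K ((Ideal.span (W : Set A)).restrictScalars K) := by
  have := hV.finrank_quotient_add_le W hW hW0
  have := finrank_quotient_add_finrank_restrictScalars (K := K) (Ideal.span (W : Set A))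
  omega

/-- Geometrically, a subscheme of length at most `n + 1` imposes independent conditions on
hyperplanes. If `V ∩ J = 0`, this is a dimension count. Otherwise the ideal generated by `V ∩ J`
lies in `J`, so linear generality bounds `dim (V ∩ J)` by exactly what the count needs. -/
theorem sup_eq_top (hV : IsLinearlyGeneral n V) {J : Ideal A}
    (hJ : finrank K A ≤ finrank K (J.restrictScalars K) + n + 1) :
    V ⊔ J.restrictScalars K = ⊤ := by
  apply Submodule.eq_top_of_finrank_eq
  have h := Submodule.finrank_sup_add_finrank_inf_eq V (J.restrictScalars K)
  rw [hV.finrank_eq] at h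
  have hle := Submodule.finrank_le (V ⊔ J.restrictScalars K)
  by_cases h0 : V ⊓ J.restrictScalars K = ⊥
  · rw [h0, finrank_bot] at h
    omega
  · have h1 := hV.finrank_le_finrank_span inf_le_left h0
    have h2 : (Ideal.span ((V ⊓ J.restrictScalars K : Submodule K A) : Set A)).restrictScalars K ≤
        J.restrictScalars K :=
      Ideal.span_le.mpr fun x hx => hx.2
    have := Submodule.finrank_mono h2
    omega

theorem finrank_inf (hV : IsLinearlyGeneral n V) {J : Ideal A} {c : ℕ} (hc : c ≤ n)
    (hJ : finrank K A = finrank K (J.restrictScalars K) + c) :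
    finrank K (V ⊓ J.restrictScalars K : Submodule K A) + c = n + 1 := by
  have h := Submodule.finrank_sup_add_finrank_inf_eq V (J.restrictScalars K)
  rw [hV.finrank_eq, hV.sup_eq_top (by omega), finrank_top] at h
  omega

/-- An ideal of small colength is generated by the elements of `V` that it contains. -/
theorem span_inf (hV : IsLinearlyGeneral n V) {J : Ideal A} {c : ℕ} (hc : c ≤ n)
    (hJ : finrank K A = finrank K (J.restrictScalars K) + c) :
    Ideal.span ((V ⊓ J.restrictScalars K : Submodule K A) : Set A) = J := by
  have h := hV.finrank_inf hc hJ
  have h0 : V ⊓ J.restrictScalars K ≠ ⊥ := by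
    intro h0
    rw [h0, finrank_bot] at h
    omega
  have h1 := hV.finrank_le_finrank_span inf_le_left h0
  have h2 : (Ideal.span ((V ⊓ J.restrictScalars K : Submodule K A) : Set A)).restrictScalars K ≤
      J.restrictScalars K :=
    Ideal.span_le.mpr fun x hx => hx.2
  exact Submodule.restrictScalars_injective K A A
    (Submodule.eq_of_le_of_finrank_le h2 (by omega))

/-- Multiplication by an element of `V` has small kernel. -/
theorem finrank_ker_mulLeft_le (hV : IsLinearlyGeneral n V) {v : A} (hv : v ∈ V) (hv0 : v ≠ 0) :
    finrank K (LinearMap.ker (LinearMap.mulLeft K v)) ≤ n := by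
  have h := hV.finrank_le_finrank_span (W := K ∙ v) (by simpa using hv) (by simpa using hv0)
  have h1 : (Ideal.span ((K ∙ v : Submodule K A) : Set A)).restrictScalars K ≤
      LinearMap.range (LinearMap.mulLeft K v) := by
    intro x hx
    have : Ideal.span ((K ∙ v : Submodule K A) : Set A) ≤ Ideal.span {v} := by
      refine Ideal.span_le.mpr fun y hy => ?_
      obtain ⟨e, rfl⟩ := Submodule.mem_span_singleton.mp hy
      exact Submodule.smul_of_tower_mem _ e (Ideal.mem_span_singleton_self v)
    obtain ⟨a, rfl⟩ := Ideal.mem_span_singleton'.mp (this hx)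
    exact ⟨a, by simp [mul_comm]⟩
  have := Submodule.finrank_mono h1
  have := LinearMap.finrank_range_add_finrank_ker (LinearMap.mulLeft K v)
  rw [finrank_span_singleton hv0] at h
  omega

/-- Multiplication by `w` has image of dimension at least `dim A - n > n`, too large to fit into the
kernel of multiplication by `v`. -/
theorem mul_ne_zero (hV : IsLinearlyGeneral n V) (hA : 2 * n < finrank K A) {v w : A} (hv : v ∈ V)
    (hw : w ∈ V) (hv0 : v ≠ 0) (hw0 : w ≠ 0) : v * w ≠ 0 := by
  intro h
  have h1 := hV.finrank_ker_mulLeft_le hv hv0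
  have h2 := hV.finrank_ker_mulLeft_le hw hw0
  have h3 : LinearMap.range (LinearMap.mulLeft K w) ≤ LinearMap.ker (LinearMap.mulLeft K v) := by
    rintro _ ⟨a, rfl⟩
    simp [← mul_assoc, h]
  have := Submodule.finrank_mono h3
  have := LinearMap.finrank_range_add_finrank_ker (LinearMap.mulLeft K w)
  omega

/-- Castelnuovo's bound for the Hilbert function of a finite scheme in linearly general position:
the subscheme defined by `I` imposes at least `min (deg, n * k + 1)` conditions in degree `k`. -/
theorem min_le_finrank_pow_sup [IsAlgClosed K] (hV : IsLinearlyGeneral n V) (k : ℕ)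
    (I : Ideal A) :
    min (finrank K A) (finrank K (I.restrictScalars K) + n * k + 1) ≤
      finrank K (V ^ k ⊔ I.restrictScalars K : Submodule K A) := by
  induction k generalizing I with
  | zero =>
    by_cases hI : I = ⊤
    · subst hI
      rw [Submodule.restrictScalars_top, sup_top_eq, finrank_top]
      exact min_le_left _ _
    · have h1 : I.restrictScalars K < V ^ 0 ⊔ I.restrictScalars K := by
        refine lt_of_le_of_ne le_sup_right fun h => hI ?_
        rw [Ideal.eq_top_iff_one]
        have : (1 : A) ∈ V ^ 0 ⊔ I.restrictScalars K :=
          Submodule.mem_sup_left (by rw [pow_zero]; exact Submodule.one_le.mp le_rfl)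
        rwa [← h] at this
      have := Submodule.finrank_lt_finrank_of_lt h1
      omega
  | succ k ih =>
    have hVk : V ≤ V ^ (k + 1) := by
      simpa using pow_le_pow_of_one_mem hV.one_mem (show 1 ≤ k + 1 by omega)
    by_cases hI : finrank K A ≤ finrank K (I.restrictScalars K) + n + 1
    · have h : V ^ (k + 1) ⊔ I.restrictScalars K = ⊤ :=
        top_le_iff.mp ((hV.sup_eq_top hI).symm.le.trans (sup_le_sup_right hVk _))
      rw [h, finrank_top]
      exact min_le_left _ _
    -- Pick a length `n` subscheme of the scheme defined by `I`. Exactly one hyperplane `v` passes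
    -- through it, and `v` generates its ideal `J`.
    · obtain ⟨J, hIJ, hJ⟩ := exists_ideal_finrank_eq (K := K) I
        (m := finrank K A - n) (by omega) (by omega)
      have hJ' : finrank K A = finrank K (J.restrictScalars K) + n := by omega
      have hW := hV.finrank_inf le_rfl hJ'
      obtain ⟨v, hv0, hvW⟩ := finrank_eq_one_iff'.mp
        (show finrank K (V ⊓ J.restrictScalars K : Submodule K A) = 1 by omega)
      have hvV : (v : A) ∈ V := v.2.1
      have hJv : J = Ideal.span {(v : A)} := by
        refine (hV.span_inf le_rfl hJ').symm.trans ?_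
        refine le_antisymm (Ideal.span_le.mpr fun x hx => ?_)
          (Ideal.span_le.mpr (by simpa using Ideal.subset_span v.2))
        obtain ⟨c, hc⟩ := hvW ⟨x, hx⟩
        have hc' : c • (v : A) = x := congrArg Subtype.val hc
        rw [← hc']
        exact Submodule.smul_of_tower_mem _ c (Ideal.mem_span_singleton_self _)
      set m := LinearMap.mulLeft K (v : A) with hm
      have hrange : LinearMap.range m = J.restrictScalars K := by
        ext x
        rw [hJv, Submodule.restrictScalars_mem, Ideal.mem_span_singleton']
        constructor
        · rintro ⟨a, rfl⟩
          exact ⟨a, by simp [hm, mul_comm]⟩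
        · rintro ⟨a, rfl⟩
          exact ⟨a, by simp [hm, mul_comm]⟩
      have hker : finrank K (LinearMap.ker m) = n := by
        have := LinearMap.finrank_range_add_finrank_ker m
        rw [hrange] at this
        omega
      -- The colon ideal `(I : v)` defines the residual scheme, to which the induction hypothesis is
      -- applied.
      let I' : Ideal A := Submodule.comap (LinearMap.lsmul A A (v : A)) I
      have hI'mem : ∀ x, x ∈ I'.restrictScalars K ↔ (v : A) * x ∈ I := fun x => Iff.rfl
      have hkerI' : LinearMap.ker m ≤ I'.restrictScalars K := by
        intro x hx
        rw [hI'mem]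
        rw [LinearMap.mem_ker, hm, LinearMap.mulLeft_apply] at hx
        rw [hx]
        exact I.zero_mem
      have hmapI' : (I'.restrictScalars K).map m = I.restrictScalars K := by
        apply le_antisymm
        · rintro _ ⟨x, hx, rfl⟩
          exact hx
        · intro x hx
          obtain ⟨y, rfl⟩ : x ∈ LinearMap.range m := by
            rw [hrange]
            exact hIJ hx
          exact ⟨y, hx, rfl⟩
      have hdim : ∀ U : Submodule K A, LinearMap.ker m ≤ U →
          finrank K (U.map m) + n = finrank K U := by
        intro U hU
        have h := finrank_map_add_finrank_inf_ker m U
        rwa [inf_eq_right.mpr hU, hker] at h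
      have h1 := hdim _ hkerI'
      rw [hmapI'] at h1
      have h2 := hdim (V ^ k ⊔ I'.restrictScalars K) (hkerI'.trans le_sup_right)
      have h3 : (V ^ k ⊔ I'.restrictScalars K).map m ≤
          (V ^ (k + 1) ⊔ I.restrictScalars K) ⊓ J.restrictScalars K := by
        refine le_inf ?_ (hrange ▸ LinearMap.map_le_range)
        rw [Submodule.map_sup, hmapI']
        refine sup_le_sup_right ?_ _
        rintro _ ⟨x, hx, rfl⟩
        rw [pow_succ']
        exact Submodule.mul_mem_mul hvV hx
      have h4 := Submodule.finrank_mono h3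
      have h5 := Submodule.finrank_sup_add_finrank_inf_eq (V ^ (k + 1) ⊔ I.restrictScalars K)
        (J.restrictScalars K)
      have h6 : (V ^ (k + 1) ⊔ I.restrictScalars K) ⊔ J.restrictScalars K = ⊤ :=
        top_le_iff.mp ((hV.sup_eq_top (J := J) (by omega)).symm.le.trans
          (sup_le_sup_right (hVk.trans le_sup_left) _))
      rw [h6, finrank_top] at h5
      -- The loss of `n` in the kernel of multiplication by `v` is made up by the colength `n` of
      -- `J`, so `dim (V ^ (k + 1) + I) ≥ dim (V ^ k + I')`. The new summand `n` comes from `dim I'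
      -- = dim I + n`.
      have h7 := ih I'
      rw [show n * (k + 1) = n * k + n by ring]
      omega

end IsLinearlyGeneral

end LinearlyGeneralPosition

/-! ### Kronecker chains in pencils without eigenvectors. -/

section Pencil

variable {K A : Type*} [Field K] [AddCommGroup A] [Module K A]

/-- Inside `V × V` the subspace `V × H` has codimension `dim V - dim H`, so intersecting with it
costs `N` at most that many dimensions. -/
theorem finrank_le_finrank_inf_comap_snd_add_one [Module.Finite K A] {V : Submodule K A}
    {N : Submodule K (A × A)} (hNV : N ≤ V.prod V) (hN : finrank K V ≤ finrank K N + 1)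
    {H : Submodule K A} (hH : H ≤ V) :
    finrank K H ≤ finrank K (N ⊓ H.comap (LinearMap.snd K A A) : Submodule K (A × A)) + 1 := by
  have h1 := Submodule.finrank_sup_add_finrank_inf_eq N (V.prod H)
  have h2 : N ⊔ V.prod H ≤ V.prod V := sup_le hNV (Submodule.prod_mono le_rfl hH)
  have h3 := Submodule.finrank_mono h2
  have h4 : N ⊓ V.prod H ≤ N ⊓ H.comap (LinearMap.snd K A A) := fun x hx => ⟨hx.1, hx.2.2⟩
  have h5 := Submodule.finrank_mono h4
  rw [finrank_submodule_prod] at h1 h3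
  omega

/-- Kronecker's normal form of a pencil without eigenvectors: a space `N` of pairs in `V`, of
dimension at least `dim V - 1`, is spanned by the consecutive pairs of a chain of vectors. -/
theorem exists_chain_of_pencil [IsAlgClosed K] [Module.Finite K A] {n : ℕ} {V : Submodule K A}
    (hV : finrank K V = n + 1) {N : Submodule K (A × A)} (hNV : N ≤ V.prod V)
    (hN : n ≤ finrank K N) (h₀ : ∀ g, (0, g) ∈ N → g = 0)
    (h₁ : ∀ (f : A) (c : K), (f, c • f) ∈ N → f = 0) :
    ∃ u : ℕ → A, (∀ i < n, (u i, u (i + 1)) ∈ N) ∧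
      LinearIndependent K fun i : Fin (n + 1) => u i := by
  -- `H` consists of starting vectors of chains with `k` links. Prepending a link costs at most one
  -- dimension, as the first projection is injective on `N` by `h₀`; after `n` links at least one of
  -- the `n + 1` dimensions survives.
  have hchain : ∀ k, ∃ H : Submodule K A, H ≤ V ∧ n + 1 ≤ finrank K H + k ∧
      ∀ v ∈ H, ∃ u : ℕ → A, u 0 = v ∧ ∀ i < k, (u i, u (i + 1)) ∈ N := by
    intro k
    induction k with
    | zero => exact ⟨V, le_rfl, by omega, fun v _ => ⟨fun _ => v, rfl, by simp⟩⟩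
    | succ k ih =>
      obtain ⟨H, hHV, hH, hu⟩ := ih
      have h := finrank_le_finrank_inf_comap_snd_add_one hNV (by omega) hHV
      set M := N ⊓ H.comap (LinearMap.snd K A A) with hM
      refine ⟨M.map (LinearMap.fst K A A), ?_, ?_, ?_⟩
      · rintro _ ⟨x, hx, rfl⟩
        exact (hNV hx.1).1
      · have h2 := finrank_map_add_finrank_inf_ker (LinearMap.fst K A A) M
        have h3 : M ⊓ LinearMap.ker (LinearMap.fst K A A) = ⊥ := by
          rw [eq_bot_iff]
          rintro ⟨f, g⟩ ⟨hfg, hf⟩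
          obtain rfl : f = 0 := hf
          simp [h₀ g hfg.1]
        rw [h3, finrank_bot] at h2
        omega
      · rintro _ ⟨⟨v, w⟩, hx, rfl⟩
        obtain ⟨u, hu0, hu⟩ := hu w hx.2
        refine ⟨fun i => Nat.casesOn i v u, rfl, fun i hi => ?_⟩
        cases i with
        | zero =>
          simp only [hu0]
          exact hx.1
        | succ i => exact hu i (by omega)
  obtain ⟨H, -, hH, hu⟩ := hchain n
  obtain ⟨v, hv, hv0⟩ := Submodule.exists_mem_ne_zero_of_ne_bot
    (show H ≠ ⊥ by rintro rfl; rw [finrank_bot] at hH; omega)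
  obtain ⟨u, rfl, hu⟩ := hu v hv
  refine ⟨u, hu, ?_⟩
  -- Encode linear combinations of the chain as polynomials, with `X ^ i` standing for `u i`;
  -- multiplication by `X` is then the shift along `N`.
  let ev : Polynomial K →ₗ[K] A :=
    Polynomial.lsum fun i => LinearMap.toSpanSingleton K A (u i)
  have hev : ∀ i c, ev (Polynomial.monomial i c) = c • u i := by
    intro i c
    simp [ev, Polynomial.lsum_apply, Polynomial.sum_monomial_index]
  have hpair : ∀ p : Polynomial K, p.natDegree < n → (ev p, ev (Polynomial.X * p)) ∈ N := by
    intro p hp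
    have h1 := p.as_sum_range' n hp
    have h2 : Polynomial.X * p = ∑ i ∈ Finset.range n, Polynomial.monomial (i + 1) (p.coeff i) := by
      conv_lhs => rw [h1, Finset.mul_sum]
      simp [Polynomial.X_mul_monomial]
    have h3 : (ev p, ev (Polynomial.X * p)) =
        ∑ i ∈ Finset.range n, p.coeff i • (u i, u (i + 1)) := by
      rw [h2]
      ext
      · conv_lhs => rw [h1]
        simp [hev, Prod.fst_sum]
      · simp [hev, Prod.snd_sum]
    rw [h3]
    exact Submodule.sum_mem _ fun i hi =>
      N.smul_mem _ (hu i (Finset.mem_range.mp hi))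
  -- A relation `p = (X - c) * p'` makes `ev p'` an eigenvector with eigenvalue `c`, so `ev p' = 0`
  -- by `h₁`: a relation of smaller degree.
  have hinj : ∀ (m : ℕ) (p : Polynomial K), p.natDegree = m → m ≤ n → ev p = 0 → p = 0 := by
    intro m
    induction m with
    | zero =>
      intro p hp _ h
      rw [Polynomial.eq_C_of_natDegree_eq_zero hp, ← Polynomial.monomial_zero_left, hev] at h
      rw [Polynomial.eq_C_of_natDegree_eq_zero hp, (smul_eq_zero.mp h).resolve_right hv0, map_zero]
    | succ m ih =>
      intro p hp hm h
      obtain ⟨c, hc⟩ := IsAlgClosed.exists_root p (by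
        rw [Polynomial.degree_eq_natDegree (by rintro rfl; simp at hp), hp]
        exact_mod_cast Nat.succ_ne_zero m)
      obtain ⟨p', rfl⟩ := Polynomial.dvd_iff_isRoot.mpr hc
      have hp'0 : p' ≠ 0 := by
        rintro rfl
        simp at hp
      rw [Polynomial.natDegree_mul (Polynomial.X_sub_C_ne_zero c) hp'0,
        Polynomial.natDegree_X_sub_C] at hp
      have hN' := hpair p' (by omega)
      rw [sub_mul, map_sub, sub_eq_zero] at h
      rw [h, ← Polynomial.smul_eq_C_mul, map_smul] at hN'
      exact absurd (ih p' (by omega) (by omega) (h₁ _ _ hN')) hp'0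
  rw [Fintype.linearIndependent_iff]
  intro g hg i
  have := hinj _ (∑ i : Fin (n + 1), Polynomial.monomial i (g i)) rfl
    (Polynomial.natDegree_sum_le_of_forall_le _ _ fun i _ =>
      (Polynomial.natDegree_monomial_le _).trans (by omega)) (by simpa [hev] using hg)
  have := congrArg (Polynomial.coeff · (i : ℕ)) this
  simpa [Polynomial.finsetSum_coeff, Polynomial.coeff_monomial, Fin.val_inj] using this

end Pencil

/-! ### Castelnuovo's lemma: equality in the bound produces vanishing minors. -/

section Castelnuovo

variable {K A : Type*} [Field K] [CommRing A] [Algebra K A] [Module.Finite K A] {n q : ℕ}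
  {V : Submodule K A}

/-- The symmetric form `(x, y) ↦ φ (x * y)` has radical inside `I`, so orthogonal subspaces have
total dimension at most `dim A + dim I`. -/
theorem finrank_add_finrank_le_of_mul_eq_zero (φ : A →ₗ[K] K) (I : Ideal A)
    (hI : ∀ x, (∀ a, φ (x * a) = 0) → x ∈ I) {X Y : Submodule K A}
    (h : ∀ x ∈ X, ∀ y ∈ Y, φ (x * y) = 0) :
    finrank K X + finrank K Y ≤ finrank K A + finrank K (I.restrictScalars K) := by
  let B : LinearMap.BilinForm K A := (LinearMap.mul K A).compr₂ φ
  have hB : ∀ x y, B x y = φ (x * y) := fun x y => rfl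
  have hs : B.IsSymm := ⟨fun x y => by simp [hB, mul_comm]⟩
  have h1 := LinearMap.BilinForm.finrank_add_finrank_orthogonal hs.isRefl X
  have h2 : Y ≤ B.orthogonal X := fun y hy x hx => h x hx y hy
  have h3 : X ⊓ B.orthogonal ⊤ ≤ I.restrictScalars K := by
    rintro x ⟨-, hx⟩
    refine hI x fun a => ?_
    rw [mul_comm]
    exact hx a trivial
  have := Submodule.finrank_mono h2
  have := Submodule.finrank_mono h3
  omega

/-- If `V ^ q` does not separate a scheme of degree `n * q + 2` in linearly general position, then
the scheme is Gorenstein with dualizing functional vanishing on `V ^ q`, and its Hilbert function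
is the minimal one. -/
theorem IsLinearlyGeneral.exists_functional [IsAlgClosed K]
    (hV : IsLinearlyGeneral n V) (hq : 3 ≤ q)
    {I : Ideal A} (hI : finrank K A = finrank K (I.restrictScalars K) + n * q + 2)
    (hVq : V ^ q ⊔ I.restrictScalars K ≠ ⊤) :
    ∃ φ : A →ₗ[K] K, (∀ x ∈ V ^ q, φ x = 0) ∧ (∀ x, (∀ a, φ (x * a) = 0) → x ∈ I) ∧
      finrank K (V ^ 2 ⊔ I.restrictScalars K : Submodule K A) ≤
        finrank K (I.restrictScalars K) + 2 * n + 1 := by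
  obtain ⟨φ, hφ0, hφ⟩ := Submodule.exists_le_ker_of_lt_top _ (lt_top_iff_ne_top.mpr hVq)
  have hφV : ∀ x ∈ V ^ q, φ x = 0 := fun x hx => hφ (Submodule.mem_sup_left hx)
  have hφI : ∀ x ∈ I, φ x = 0 := fun x hx => hφ (Submodule.mem_sup_right hx)
  -- The largest ideal inside the kernel of `φ`. The goal is `I' = I`, which makes `A ⧸ I`
  -- Gorenstein with `φ` as dualizing functional.
  let I' : Ideal A :=
    { carrier := {x | ∀ a, φ (x * a) = 0}
      add_mem' := fun {x y} hx hy a => by rw [add_mul, map_add, hx, hy, add_zero]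
      zero_mem' := fun a => by simp
      smul_mem' := fun b x hx a => by
        rw [smul_eq_mul, mul_comm b x, mul_assoc]
        exact hx _ }
  have hmem : ∀ x, x ∈ I' ↔ ∀ a, φ (x * a) = 0 := fun x => Iff.rfl
  have hII' : I ≤ I' := fun x hx a => hφI _ (I.mul_mem_right a hx)
  have hI'top : I' ≠ ⊤ := by
    intro h
    refine hφ0 (LinearMap.ext fun a => ?_)
    have : (1 : A) ∈ I' := h ▸ trivial
    simpa using this a
  have hI'lt : finrank K (I'.restrictScalars K) < finrank K A :=
    Submodule.finrank_lt (by simpa using hI'top)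
  have horth : ∀ a b, a + b = q →
      finrank K (V ^ a ⊔ I'.restrictScalars K : Submodule K A) +
        finrank K (V ^ b ⊔ I'.restrictScalars K : Submodule K A) ≤
      finrank K A + finrank K (I'.restrictScalars K) := by
    intro a b hab
    refine finrank_add_finrank_le_of_mul_eq_zero φ I' (fun x hx => hx) ?_
    intro x hx y hy
    obtain ⟨x, hxV, i, hi, rfl⟩ := Submodule.mem_sup.mp hx
    obtain ⟨y, hyV, j, hj, rfl⟩ := Submodule.mem_sup.mp hy
    have h1 : φ (x * y) = 0 := hφV _ (hab ▸ pow_add V a b ▸ Submodule.mul_mem_mul hxV hyV)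
    have h2 : φ (i * (y + j)) = 0 := hi _
    have h3 : φ (j * x) = 0 := hj _
    rw [show (x + i) * (y + j) = x * y + i * (y + j) + j * x by ring, map_add, map_add, h1, h2, h3]
    simp
  -- `V` and `V ^ (q - 1)` are orthogonal, while Castelnuovo's bound gives them at least `n + 1` and
  -- `n * (q - 1) + 1` dimensions modulo `I'`, unless they fill `A`, which orthogonality excludes.
  -- The total `n * q + 2` leaves no room for an `I'` larger than `I`.
  have hII'eq : I' = I := by
    have h1 := horth 1 (q - 1) (by omega)
    have h2 := hV.min_le_finrank_pow_sup 1 I'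
    have h3 := hV.min_le_finrank_pow_sup (q - 1) I'
    have h4 : n * (q - 1) + n = n * q := by
      rw [← Nat.mul_succ]; congr 1; omega
    have h5 := Submodule.finrank_mono
      (show I.restrictScalars K ≤ I'.restrictScalars K from hII')
    exact (Submodule.restrictScalars_injective K A A (Submodule.eq_of_le_of_finrank_le
      (show I.restrictScalars K ≤ I'.restrictScalars K from hII') (by omega))).symm
  refine ⟨φ, hφV, fun x hx => hII'eq ▸ hx, ?_⟩
  -- `V ^ (q - 2)` has at least `n * (q - 2) + 1` dimensions modulo `I`, which leaves at most `2 * n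
  -- + 1` for its orthogonal partner `V ^ 2`.
  have h1 := horth 2 (q - 2) (by omega)
  have h3 := hV.min_le_finrank_pow_sup (q - 2) I'
  have h4 : n * (q - 2) + 2 * n = n * q := by
    obtain ⟨m, rfl⟩ := Nat.exists_eq_add_of_le (show 2 ≤ q by omega)
    rw [Nat.add_sub_cancel_left]; ring
  rw [hII'eq] at h1 h3
  have h5 := Submodule.finrank_mono
      (show I.restrictScalars K ≤ V ^ 2 ⊔ I.restrictScalars K from le_sup_right)
  omega

/-- Castelnuovo's lemma: a scheme of degree at least `n * q + 2` in linearly general position that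
imposes only `n * q + 1` conditions in degree `q` satisfies the equations of a rational normal
curve. -/
theorem IsLinearlyGeneral.exists_basis_minors_eq_zero [IsAlgClosed K]
    (hV : IsLinearlyGeneral n V) (hn : 1 ≤ n)
    (hq : 3 ≤ q) (hVq : finrank K (V ^ q : Submodule K A) = n * q + 1)
    (hA : n * q + 2 ≤ finrank K A) :
    ∃ u : ℕ → A, (∀ i ≤ n, u i ∈ V) ∧ (LinearIndependent K fun i : Fin (n + 1) => u i) ∧
      ∀ i < n, ∀ j < n, u i * u (j + 1) = u (i + 1) * u j := by
  have hnq : 3 * n ≤ n * q := by rw [mul_comm]; exact Nat.mul_le_mul_left n hq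
  -- Colength `n * q + 2` is one more than `dim V ^ q`: small enough for `V ^ q` to inject modulo
  -- `I`, by Castelnuovo's bound, yet too large for it to be surjective.
  obtain ⟨I, -, hI⟩ := exists_ideal_finrank_eq (K := K) (⊥ : Ideal A)
    (m := finrank K A - (n * q + 2)) (by
      rw [Submodule.restrictScalars_bot, finrank_bot]; exact Nat.zero_le _) (by omega)
  have hb := hV.min_le_finrank_pow_sup q I
  have hsi := Submodule.finrank_sup_add_finrank_inf_eq (V ^ q) (I.restrictScalars K)
  have hVI : V ^ q ⊓ I.restrictScalars K = ⊥ := by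
    rw [← Submodule.finrank_eq_zero (R := K)]
    omega
  obtain ⟨φ, hφV, hφI, hV2⟩ := hV.exists_functional hq (I := I) (by omega) (by
    intro h
    rw [h, finrank_top] at hsi
    omega)
  have hV2I : ∀ z ∈ V ^ 2, z ∈ I → z = 0 := by
    intro z hz hzI
    have : z ∈ V ^ q ⊓ I.restrictScalars K :=
      ⟨pow_le_pow_of_one_mem hV.one_mem (by omega) hz, hzI⟩
    simpa [hVI] using this
  -- Colength `n - 1` makes `V ∩ J` two-dimensional: a pencil of hyperplanes with basis `s, t`,
  -- which also generates `J` as an ideal.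
  obtain ⟨J, hIJ, hJ⟩ := exists_ideal_finrank_eq (K := K) I
    (m := finrank K A - (n - 1)) (by omega) (by omega)
  have hJ' : finrank K A = finrank K (J.restrictScalars K) + (n - 1) := by omega
  have hP := hV.finrank_inf (by omega) hJ'
  have hVJ := hV.sup_eq_top (J := J) (by omega)
  obtain ⟨b⟩ : Nonempty (Basis (Fin 2) K (V ⊓ J.restrictScalars K : Submodule K A)) :=
    ⟨finBasisOfFinrankEq K _ (by omega)⟩
  obtain ⟨s, hs⟩ : ∃ s, s = (b 0 : A) := ⟨_, rfl⟩
  obtain ⟨t, ht⟩ : ∃ t, t = (b 1 : A) := ⟨_, rfl⟩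
  have hsV : s ∈ V := hs ▸ (b 0).2.1
  have htV : t ∈ V := ht ▸ (b 1).2.1
  have hsJ : s ∈ J := hs ▸ (b 0).2.2
  have htJ : t ∈ J := ht ▸ (b 1).2.2
  have hst : ∀ c d : K, c • s + d • t = 0 → c = 0 ∧ d = 0 := by
    intro c d h
    have h2 := Fintype.linearIndependent_iff.mp b.linearIndependent ![c, d] (by
      ext
      simpa [Fin.sum_univ_two, ← hs, ← ht] using h)
    exact ⟨h2 0, h2 1⟩
  have hJst : ∀ z, z * s = 0 → z * t = 0 → ∀ a ∈ J, z * a = 0 := by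
    intro z hzs hzt a ha
    have hle : J ≤ LinearMap.ker (LinearMap.lsmul A A z) := by
      rw [← hV.span_inf (by omega) hJ']
      refine Ideal.span_le.mpr fun x hx => ?_
      have := congrArg Subtype.val (b.sum_repr ⟨x, hx⟩)
      simp only [Fin.sum_univ_two, Submodule.coe_add, Submodule.coe_smul, ← hs, ← ht] at this
      change z * x = 0
      rw [← this, mul_add, mul_smul_comm, mul_smul_comm, hzs, hzt]
      simp
    exact hle ha
  -- the pairs `(f, g)` in `V` with `f / g = s / t`
  let D : (A × A) →ₗ[K] A :=
    LinearMap.mulLeft K s ∘ₗ LinearMap.snd K A A - LinearMap.mulLeft K t ∘ₗ LinearMap.fst K A A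
  have hD : ∀ f g, D (f, g) = s * g - t * f := fun f g => rfl
  have hmul : ∀ {f g}, f ∈ V → g ∈ V → f * g ∈ V ^ 2 := fun hf hg => by
    rw [pow_two]; exact Submodule.mul_mem_mul hf hg
  let N : Submodule K (A × A) := V.prod V ⊓ LinearMap.ker D
  have hNmem : ∀ f g, (f, g) ∈ N ↔ (f ∈ V ∧ g ∈ V) ∧ s * g = t * f := by
    intro f g
    rw [← sub_eq_zero (a := s * g), ← hD]
    exact Iff.rfl
  -- `D` sends the `2 * (n + 1)`-dimensional `V × V` into `V ^ 2 ∩ J`, of dimension at most `(2 * n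
  -- + 1) - (n - 1) = n + 2`.
  have hNdim : n ≤ finrank K N := by
    have h1 := finrank_map_add_finrank_inf_ker D (V.prod V)
    rw [finrank_submodule_prod, hV.finrank_eq] at h1
    have h2 : (V.prod V).map D ≤ V ^ 2 ⊓ J.restrictScalars K := by
      rintro _ ⟨⟨f, g⟩, ⟨hf, hg⟩, rfl⟩
      exact ⟨Submodule.sub_mem _ (hmul hsV hg) (hmul htV hf),
        J.sub_mem (J.mul_mem_right _ hsJ) (J.mul_mem_right _ htJ)⟩
    have h3 := Submodule.finrank_mono h2
    have h4 := Submodule.finrank_sup_add_finrank_inf_eq (V ^ 2) (I.restrictScalars K)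
    have h5 : V ^ 2 ⊓ I.restrictScalars K = ⊥ :=
      eq_bot_iff.mpr fun z hz => hV2I z hz.1 hz.2
    rw [h5, finrank_bot] at h4
    have h6 := Submodule.finrank_sup_add_finrank_inf_eq (V ^ 2) (J.restrictScalars K)
    have h7 : V ^ 2 ⊔ J.restrictScalars K = ⊤ := by
      refine top_le_iff.mp (hVJ.symm.le.trans (sup_le_sup_right ?_ _))
      simpa using pow_le_pow_of_one_mem hV.one_mem (show 1 ≤ 2 by omega)
    rw [h7, finrank_top] at h6
    change n ≤ finrank K (V.prod V ⊓ LinearMap.ker D : Submodule K (A × A))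
    omega
  -- The minor `z` kills `s` and `t`, hence `J`. As `A = V + J`, this gives `z * A ⊆ V ^ 3 ⊆ V ^ q`,
  -- where `φ` vanishes; so `z` lies in `I`, which meets `V ^ 2` only in zero.
  have hNminor : ∀ f g f' g', (f, g) ∈ N → (f', g') ∈ N → f * g' = g * f' := by
    intro f g f' g' h h'
    rw [hNmem] at h h'
    obtain ⟨⟨hf, hg⟩, h⟩ := h
    obtain ⟨⟨hf', hg'⟩, h'⟩ := h'
    have hz : f * g' - g * f' ∈ V ^ 2 := Submodule.sub_mem _ (hmul hf hg') (hmul hg hf')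
    have hzJ := hJst (f * g' - g * f') (by linear_combination f * h' - f' * h)
      (by linear_combination g * h' - g' * h)
    refine sub_eq_zero.mp (hV2I _ hz (hφI _ fun a => ?_))
    obtain ⟨w, hw, j, hj, rfl⟩ := Submodule.mem_sup.mp (hVJ.symm ▸ Submodule.mem_top (x := a))
    rw [mul_add, hzJ j hj, add_zero]
    apply hφV
    rw [show q = 2 + (q - 2) by omega, pow_add]
    refine Submodule.mul_mem_mul hz (pow_le_pow_of_one_mem hV.one_mem
      (show 1 ≤ q - 2 by omega) (by simpa using hw))
  have hs0 : s ≠ 0 := fun h => one_ne_zero (hst 1 0 (by simp [h])).1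
  -- A bad vector would give `s * g = 0` or `(c • s - t) * f = 0` with nonzero factors in `V`, which
  -- `mul_ne_zero` forbids.
  obtain ⟨u, hu, hli⟩ := exists_chain_of_pencil hV.finrank_eq (N := N) inf_le_left hNdim
    (by
      intro g hg
      rw [hNmem] at hg
      by_contra hg0
      exact hV.mul_ne_zero (by omega) hsV hg.1.2 hs0 hg0 (by simpa using hg.2))
    (by
      intro f c hf
      rw [hNmem] at hf
      by_contra hf0
      refine hV.mul_ne_zero (v := c • s - t) (by omega) (V.sub_mem (V.smul_mem c hsV) htV) hf.1.1
        ?_ hf0 ?_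
      · intro h
        exact neg_ne_zero.mpr one_ne_zero (hst c (-1) (by rw [← h]; simp [sub_eq_add_neg])).2
      · rw [sub_mul, ← hf.2]
        simp)
  refine ⟨u, fun i hi => ?_, hli, fun i hi j hj => hNminor _ _ _ _ (hu i hi) (hu j hj)⟩
  rcases Nat.lt_or_ge i n with h | h
  · exact ((hNmem _ _).mp (hu i h)).1.1
  · obtain ⟨m, rfl⟩ := Nat.exists_eq_add_of_le' hn
    obtain rfl : i = m + 1 := by omega
    exact ((hNmem _ _).mp (hu m (by omega))).1.2

end Castelnuovo

/-! ### Homogeneous polynomials. -/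

section Homogeneous

variable {K : Type*} [Field K]

theorem aeval_mul_of_isHomogeneous {σ A : Type*} [CommRing A] [Algebra K A] {f : MvPolynomial σ K}
    {k : ℕ} (hf : f.IsHomogeneous k) (c : A) (x : σ → A) :
    aeval (fun i => c * x i) f = c ^ k * aeval x f := by
  rw [aeval_def, aeval_def, eval₂_eq, eval₂_eq, Finset.mul_sum]
  refine Finset.sum_congr rfl fun d hd => ?_
  have hdk : ∑ i ∈ d.support, d i = k := by
    rw [← Finsupp.degree_apply]
    by_contra h
    exact mem_support_iff.mp hd (hf.coeff_eq_zero h)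
  simp only [mul_pow, Finset.prod_mul_distrib, Finset.prod_pow_eq_pow_sum, hdk]
  ring

theorem eval_smul_of_isHomogeneous {σ : Type*} {f : MvPolynomial σ K} {k : ℕ}
    (hf : f.IsHomogeneous k) (c : K) (x : σ → K) : eval (c • x) f = c ^ k * eval x f := by
  have h := aeval_mul_of_isHomogeneous hf c x
  have e : ∀ y : σ → K, aeval y f = eval y f := fun y =>
    DFunLike.congr_fun (coe_aeval_eq_eval y) f
  rw [e, e] at h
  exact h

theorem homogeneousComponent_mul_of_isHomogeneous {σ : Type*} {f : MvPolynomial σ K} {m : ℕ}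
    (hf : f.IsHomogeneous m) (g : MvPolynomial σ K) (k : ℕ) :
    homogeneousComponent (k + m) (g * f) = homogeneousComponent k g * f := by
  conv_lhs => rw [← sum_homogeneousComponent g, Finset.sum_mul, map_sum]
  have h : ∀ i, homogeneousComponent (k + m) (homogeneousComponent i g * f) =
      if i = k then homogeneousComponent k g * f else 0 := by
    intro i
    rw [homogeneousComponent_of_mem ((homogeneousComponent_isHomogeneous i g).mul hf)]
    by_cases hik : i = k
    · simp [hik]
    · rw [if_neg (by omega), if_neg hik]
  simp only [h, Finset.sum_ite_eq', Finset.mem_range]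
  split_ifs with hk
  · rfl
  · rw [homogeneousComponent_eq_zero _ _ (by omega), zero_mul]

theorem isHomogeneous_of_mul {σ : Type*} {f g : MvPolynomial σ K} {k m : ℕ}
    (hf : f.IsHomogeneous m) (hf0 : f ≠ 0) (h : (g * f).IsHomogeneous (k + m)) :
    g.IsHomogeneous k := by
  have h1 := homogeneousComponent_mul_of_isHomogeneous hf g k
  rw [homogeneousComponent_eq_self h] at h1
  rw [mul_right_cancel₀ hf0 h1]
  exact homogeneousComponent_isHomogeneous k g

end Homogeneous

/-! ### Sections of twisted ideal sheaves over the standard charts. -/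

section Sections

variable {K : Type*} [Field K] {n : ℕ}

/-- The inclusion of the coordinate ring into its field of fractions. -/
abbrev toFrac (K : Type*) [Field K] (n : ℕ) : CoordRing K n →ₐ[K] Frac K n :=
  IsScalarTower.toAlgHom K (CoordRing K n) (Frac K n)

theorem toFrac_injective : Function.Injective (toFrac K n) :=
  IsFractionRing.injective (CoordRing K n) (Frac K n)

theorem toFrac_X_ne_zero (i : Fin (n + 1)) : toFrac K n (X i) ≠ 0 := by
  rw [Ne, map_eq_zero_iff _ toFrac_injective]
  exact X_ne_zero i

theorem mem_sections_chart {J : Ideal (CoordRing K n)} {q : ℕ} {i : Fin (n + 1)} {z : Frac K n} :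
    z ∈ sections J q (chart i) ↔ ∃ k : ℕ, ∃ f ∈ J, f.IsHomogeneous (q + k) ∧
      z * toFrac K n (X i) ^ k = toFrac K n f := by
  change (∃ k : ℕ, ∃ f ∈ J, f.IsHomogeneous (q + k * (chart i).degree) ∧
    z * algebraMap (CoordRing K n) (Frac K n) (X i ^ k) = _) ↔ _
  simp only [Finsupp.degree_single, mul_one, map_pow]
  rfl

theorem mem_sections_overlap {J : Ideal (CoordRing K n)} {q : ℕ} {i j : Fin (n + 1)}
    {z : Frac K n} :
    z ∈ sections J q (overlap i j) ↔ ∃ k : ℕ, ∃ f ∈ J, f.IsHomogeneous (q + k * 2) ∧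
      z * toFrac K n (X i * X j) ^ k = toFrac K n f := by
  have h : monomial (overlap i j) (1 : K) = X i * X j := by
    simp [overlap, chart, X, monomial_mul]
  change (∃ k : ℕ, ∃ f ∈ J, f.IsHomogeneous (q + k * (overlap i j).degree) ∧
    z * algebraMap (CoordRing K n) (Frac K n) (monomial (overlap i j) 1 ^ k) = _) ↔ _
  simp only [h, map_add, Finsupp.degree_single, map_pow]
  rfl

/-- A section lies in the ideal sheaf as soon as some multiple lies in the ideal. -/
theorem mem_sections_of_mul_mem {J : Ideal (CoordRing K n)} {q : ℕ} {a : Fin (n + 1) →₀ ℕ}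
    {z : Frac K n} (hz : z ∈ sections ⊤ q a) {k : ℕ} {f : CoordRing K n} (hf : f ∈ J)
    (h : z * toFrac K n (monomial a 1) ^ k = toFrac K n f) : z ∈ sections J q a := by
  obtain ⟨m, g, -, hg, hzg⟩ := hz
  have hzg' : z * toFrac K n (monomial a 1) ^ m = toFrac K n g := by rw [← map_pow]; exact hzg
  have e : g * monomial a 1 ^ k = f * monomial a 1 ^ m := by
    apply toFrac_injective
    rw [map_mul, map_mul, ← h, ← hzg', map_pow, map_pow]
    ring
  refine ⟨m + k, g * monomial a 1 ^ k, e ▸ J.mul_mem_right _ hf, ?_, ?_⟩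
  · have h2 := hg.mul ((isHomogeneous_monomial (1 : K) (rfl : a.degree = _)).pow k)
    rwa [show q + m * a.degree + a.degree * k = q + (m + k) * a.degree by ring] at h2
  · rw [pow_add, map_mul, ← mul_assoc, hzg, map_mul]

theorem sections_le_top (J : Ideal (CoordRing K n)) (q : ℕ) (a : Fin (n + 1) →₀ ℕ) :
    sections J q a ≤ sections ⊤ q a := by
  rintro z ⟨k, f, -, h⟩
  exact ⟨k, f, trivial, h⟩

theorem eventually_of_mem_sections {J : Ideal (CoordRing K n)} {q : ℕ} {a : Fin (n + 1) →₀ ℕ}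
    {z : Frac K n} (hz : z ∈ sections J q a) :
    ∀ᶠ k : ℕ in Filter.atTop, ∃ f ∈ J, f.IsHomogeneous (q + k * a.degree) ∧
      z * toFrac K n (monomial a 1) ^ k = toFrac K n f := by
  obtain ⟨m, f, hf, hfh, h⟩ := hz
  filter_upwards [Filter.eventually_ge_atTop m] with k hk
  obtain ⟨k, rfl⟩ := Nat.exists_eq_add_of_le hk
  refine ⟨f * monomial a 1 ^ k, J.mul_mem_right _ hf, ?_, ?_⟩
  · have h2 := hfh.mul ((isHomogeneous_monomial (1 : K) (rfl : a.degree = _)).pow k)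
    rwa [show q + m * a.degree + a.degree * k = q + (m + k) * a.degree by ring] at h2
  · rw [map_mul, pow_add, ← mul_assoc, map_pow]
    congr 1
    rw [← map_pow]
    exact h

theorem sections_chart_le_overlap_left (q : ℕ) (i j : Fin (n + 1)) :
    sections (⊤ : Ideal (CoordRing K n)) q (chart i) ≤ sections ⊤ q (overlap i j) := by
  intro z hz
  obtain ⟨k, f, -, hf, h⟩ := mem_sections_chart.mp hz
  refine mem_sections_overlap.mpr ⟨k, f * X j ^ k, trivial, ?_, ?_⟩
  · have := hf.mul ((isHomogeneous_X K j).pow k)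
    rwa [show q + k + 1 * k = q + k * 2 by ring] at this
  · rw [map_mul, map_mul, mul_pow, ← mul_assoc, h, map_pow]

theorem sections_chart_le_overlap_right (q : ℕ) (i j : Fin (n + 1)) :
    sections (⊤ : Ideal (CoordRing K n)) q (chart j) ≤ sections ⊤ q (overlap i j) := by
  have := sections_chart_le_overlap_left (K := K) q j i
  rwa [show overlap j i = overlap i j from add_comm _ _] at this

/-- `H⁰(ℙⁿ, 𝓞(q))` consists of the forms of degree `q`. -/
theorem exists_form_of_forall_mem_sections (hn : 1 ≤ n) {q : ℕ} {z : Frac K n}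
    (hz : ∀ i, z ∈ sections (⊤ : Ideal (CoordRing K n)) q (chart i)) :
    ∃ f : CoordRing K n, f.IsHomogeneous q ∧ z = toFrac K n f := by
  obtain ⟨k, f, -, hf, h⟩ := mem_sections_chart.mp (hz 0)
  obtain ⟨m, g, -, hg, h'⟩ := mem_sections_chart.mp (hz (Fin.last n))
  have e : X 0 ^ k * g = f * X (Fin.last n) ^ m := by
    apply toFrac_injective
    rw [map_mul, map_mul, ← h, ← h', map_pow, map_pow]
    ring
  have h0n : (0 : Fin (n + 1)) ≠ Fin.last n := by
    simp [Fin.ext_iff]; omega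
  -- The two denominators are powers of different primes, so both must cancel.
  have hd : (X 0 ^ k : CoordRing K n) ∣ f := by
    refine Prime.pow_dvd_of_dvd_mul_right X_prime k (b := X (Fin.last n) ^ m) ?_ ⟨g, e.symm⟩
    intro hdvd
    exact h0n (X_dvd_X.mp (X_prime.dvd_of_dvd_pow hdvd))
  obtain ⟨p, rfl⟩ := hd
  refine ⟨p, ?_, ?_⟩
  · rw [mul_comm] at hf
    exact isHomogeneous_of_mul (by simpa using (isHomogeneous_X K (0 : Fin (n + 1))).pow k)
      (pow_ne_zero _ (X_ne_zero _)) hf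
  · rw [map_mul, map_pow, mul_comm] at h
    exact mul_left_cancel₀ (pow_ne_zero k (toFrac_X_ne_zero 0)) h

end Sections

/-! ### Vanishing of the first cohomology of the line bundles on projective space. -/

section FirstCohomology

variable {K : Type*} [Field K] {n : ℕ}

/-- Division of a form by a power of a variable, with remainder of small degree in it. -/
theorem exists_eq_mul_X_pow_add {σ : Type*} {f : MvPolynomial σ K} (i : σ) {k m : ℕ}
    (hf : f.IsHomogeneous (m + k)) :
    ∃ Q R : MvPolynomial σ K, Q.IsHomogeneous m ∧ R.IsHomogeneous (m + k) ∧
      f = Q * X i ^ k + R ∧ ∀ d : σ →₀ ℕ, k ≤ d i → R.coeff d = 0 := by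
  classical
  have hle : ∀ d : σ →₀ ℕ, Finsupp.single i k ≤ d ↔ k ≤ d i := fun d => by simp
  have hX : monomial (Finsupp.single i k) (1 : K) = X i ^ k := by rw [X_pow_eq_monomial]
  have hR : (f.modMonomial (Finsupp.single i k)).IsHomogeneous (m + k) := by
    intro d hd
    by_cases h : Finsupp.single i k ≤ d
    · rw [coeff_modMonomial_of_le _ h] at hd
      exact absurd rfl hd
    · rw [coeff_modMonomial_of_not_le _ h] at hd
      exact hf hd
  have he := divMonomial_add_modMonomial f (Finsupp.single i k)
  rw [hX, mul_comm] at he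
  refine ⟨f.divMonomial (Finsupp.single i k), f.modMonomial (Finsupp.single i k), ?_, hR, he.symm,
    fun d hd => coeff_modMonomial_of_le _ ((hle d).mpr hd)⟩
  refine isHomogeneous_of_mul (m := k) (by simpa using (isHomogeneous_X K i).pow k)
    (pow_ne_zero _ (X_ne_zero _)) ?_
  rw [eq_sub_of_add_eq he]
  exact hf.sub hR

theorem coeff_mul_X_pow_eq_zero {σ : Type*} {R : MvPolynomial σ K} {i j : σ} (hij : i ≠ j) {k m : ℕ}
    (hR : ∀ d : σ →₀ ℕ, k ≤ d i → R.coeff d = 0) (d : σ →₀ ℕ) (hd : k ≤ d i) :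
    (R * X j ^ m).coeff d = 0 := by
  classical
  rw [X_pow_eq_monomial, coeff_mul_monomial']
  split_ifs with h
  · rw [hR, zero_mul]
    rw [Finsupp.tsub_apply, Finsupp.single_eq_of_ne hij]
    simpa using hd
  · rfl

/-- The vanishing of `H¹(ℙⁿ, 𝓞(q))`. -/
theorem exists_eq_sub_of_cocycle (hn : 2 ≤ n) {q : ℕ} {c : Fin (n + 1) → Fin (n + 1) → Frac K n}
    (hc : ∀ i j, c i j ∈ sections (⊤ : Ideal (CoordRing K n)) q (overlap i j))
    (hcc : ∀ i j k, c i j + c j k = c i k) :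
    ∃ b : Fin (n + 1) → Frac K n,
      (∀ i, b i ∈ sections (⊤ : Ideal (CoordRing K n)) q (chart i)) ∧
      ∀ i j, c i j = b j - b i := by
  classical
  have hev : ∀ᶠ k : ℕ in Filter.atTop, ∀ i j, ∃ f : CoordRing K n, f.IsHomogeneous (q + k + k) ∧
      c i j * (toFrac K n (X i) * toFrac K n (X j)) ^ k = toFrac K n f := by
    rw [Filter.eventually_all]
    intro i
    rw [Filter.eventually_all]
    intro j
    filter_upwards [eventually_of_mem_sections (hc i j)] with k hk
    obtain ⟨f, -, hf, h⟩ := hk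
    refine ⟨f, ?_, ?_⟩
    · rwa [map_add, Finsupp.degree_single, Finsupp.degree_single,
        show q + k * (1 + 1) = q + k + k by ring] at hf
    · rw [← h, ← map_mul]
      congr 3
      simp [overlap, chart, X, monomial_mul]
  obtain ⟨k, hk⟩ := hev.exists
  choose f hf hcf using hk
  have hι : ∀ i, toFrac K n (X i) ^ k ≠ 0 := fun i => pow_ne_zero _ (toFrac_X_ne_zero i)
  have hrel : ∀ i j, f 0 j * X i ^ k - f 0 i * X j ^ k = f i j * X 0 ^ k := by
    intro i j
    apply toFrac_injective
    simp only [map_sub, map_mul, map_pow, ← hcf, ← hcc 0 i j]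
    ring
  -- This splits `c 0 i` into `Q i / x_i ^ k`, regular on the chart of `x_i`, and a remainder `R i /
  -- (x_0 x_i) ^ k`.
  choose Q R hQ hR hfQR hR0 using fun i => exists_eq_mul_X_pow_add (0 : Fin (n + 1)) (hf 0 i)
  -- By the cocycle relation the difference is a multiple of `x_0 ^ k`, yet none of its monomials is
  -- divisible by `x_0 ^ k`.
  have hRR : ∀ i j, i ≠ 0 → j ≠ 0 → R j * X i ^ k = R i * X j ^ k := by
    intro i j hi hj
    rw [← sub_eq_zero]
    ext d
    rw [coeff_zero]
    by_cases hd : k ≤ d 0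
    · rw [coeff_sub, coeff_mul_X_pow_eq_zero hi.symm (hR0 j) d hd,
        coeff_mul_X_pow_eq_zero hj.symm (hR0 i) d hd, sub_zero]
    · have h := hrel i j
      rw [hfQR i, hfQR j] at h
      rw [show R j * X i ^ k - R i * X j ^ k =
        (f i j - Q j * X i ^ k + Q i * X j ^ k) * X 0 ^ k by linear_combination h,
        show (X 0 ^ k : CoordRing K n) = monomial (Finsupp.single 0 k) 1 from X_pow_eq_monomial,
        coeff_mul_monomial', if_neg (by simpa using hd)]
  -- Since `n ≥ 2` there are two indices besides `0`. Coprimality of their variables shows that `P =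
  -- R i / x_i ^ k` is a form independent of `i`, so the remainders become `P / x_0 ^ k`, regular on
  -- the chart of `x_0`.
  let i₁ : Fin (n + 1) := ⟨1, by omega⟩
  let i₂ : Fin (n + 1) := ⟨2, by omega⟩
  have h₁ : i₁ ≠ 0 := by simp [i₁, Fin.ext_iff]
  have h₂ : i₂ ≠ 0 := by simp [i₂, Fin.ext_iff]
  have h₁₂ : i₁ ≠ i₂ := by simp [i₁, i₂, Fin.ext_iff]
  have hd : (X i₁ ^ k : CoordRing K n) ∣ R i₁ := by
    refine Prime.pow_dvd_of_dvd_mul_right X_prime k (b := X i₂ ^ k) ?_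
      ⟨R i₂, by rw [← hRR i₁ i₂ h₁ h₂, mul_comm]⟩
    intro hdvd
    exact h₁₂ (X_dvd_X.mp (X_prime.dvd_of_dvd_pow hdvd))
  obtain ⟨P, hP⟩ := hd
  have hPh : P.IsHomogeneous (q + k) := by
    refine isHomogeneous_of_mul (f := X i₁ ^ k) (m := k)
      (by simpa using (isHomogeneous_X K i₁).pow k) (pow_ne_zero _ (X_ne_zero _)) ?_
    rw [mul_comm, ← hP]
    exact hR i₁
  have hRP : ∀ i, i ≠ 0 → R i = P * X i ^ k := by
    intro i hi
    refine mul_right_cancel₀ (pow_ne_zero k (X_ne_zero i₁)) ?_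
    rw [hRR i₁ i h₁ hi, hP]
    ring
  let b : Fin (n + 1) → Frac K n := fun i =>
    if i = 0 then -(toFrac K n P / toFrac K n (X 0) ^ k)
    else toFrac K n (Q i) / toFrac K n (X i) ^ k
  have hb : ∀ i, c 0 i = b i - b 0 := by
    intro i
    by_cases hi : i = 0
    · subst hi
      have := hcc 0 0 0
      rw [sub_self]
      simpa using this
    · simp only [b, if_neg hi, if_true]
      have h := hcf 0 i
      rw [hfQR i, hRP i hi] at h
      simp only [map_add, map_mul, map_pow, mul_pow] at h
      have h0 := hι 0
      have hi := hι i
      field_simp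
      linear_combination h
  refine ⟨b, fun i => ?_, fun i j => ?_⟩
  · rw [mem_sections_chart]
    by_cases hi : i = 0
    · subst hi
      refine ⟨k, -P, trivial, hPh.neg, ?_⟩
      simp only [b, if_true, map_neg, neg_mul]
      rw [div_mul_cancel₀ _ (hι 0)]
    · refine ⟨k, Q i, trivial, hQ i, ?_⟩
      simp only [b, if_neg hi]
      rw [div_mul_cancel₀ _ (hι i)]
  · have := hcc 0 i j
    rw [hb i, hb j] at this
    linear_combination this

end FirstCohomology

/-! ### Passing to the affine piece where a linear form equals one. -/

section Dehomogenization

variable {K : Type*} [Field K] {n : ℕ}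

/-- The ideal of the affine part `l = 1` of the cone defined by `J`. -/
abbrev affineIdeal (J : Ideal (CoordRing K n)) (l : CoordRing K n) : Ideal (CoordRing K n) :=
  J ⊔ Ideal.span {l - 1}

/-- The substitution `x_i ↦ x_i / l` into the localization of the quotient by `J` at `l` kills `l -
1` and, `J` being homogeneous, also `J`. It sends a form `f` of degree `k` to `f / l ^ k`, so `f`
vanishes in that localization. -/
theorem exists_pow_mul_mem_of_mem_affineIdeal {J : Ideal (CoordRing K n)}
    (hJ : ∀ f ∈ J, ∀ m : ℕ, homogeneousComponent m f ∈ J) {l : CoordRing K n}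
    (hl : l.IsHomogeneous 1) {f : CoordRing K n} {k : ℕ} (hf : f.IsHomogeneous k)
    (h : f ∈ affineIdeal J l) : ∃ m : ℕ, l ^ m * f ∈ J := by
  let B := Localization.Away (Ideal.Quotient.mk J l)
  let θ : CoordRing K n →ₐ[K] B :=
    (IsScalarTower.toAlgHom K (CoordRing K n ⧸ J) B).comp (Ideal.Quotient.mkₐ K J)
  have hθ : ∀ f, θ f = algebraMap (CoordRing K n ⧸ J) B (Ideal.Quotient.mk J f) := fun f => rfl
  let c : B := IsLocalization.Away.invSelf (Ideal.Quotient.mk J l)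
  have hc : c * θ l = 1 := by
    rw [mul_comm]
    exact IsLocalization.Away.mul_invSelf (Ideal.Quotient.mk J l)
  let ψ : CoordRing K n →ₐ[K] B := aeval fun i => c * θ (X i)
  have hψ : ∀ {f : CoordRing K n} {k : ℕ}, f.IsHomogeneous k → ψ f = c ^ k * θ f := by
    intro f k hf
    rw [aeval_mul_of_isHomogeneous hf]
    congr 1
    exact (DFunLike.congr_fun (aeval_unique θ) f).symm
  have hker : affineIdeal J l ≤ RingHom.ker ψ := by
    refine sup_le (fun f hf => ?_) (Ideal.span_le.mpr ?_)
    · rw [RingHom.mem_ker, ← sum_homogeneousComponent f, map_sum]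
      refine Finset.sum_eq_zero fun i _ => ?_
      rw [hψ (homogeneousComponent_isHomogeneous i f), hθ,
        Ideal.Quotient.eq_zero_iff_mem.mpr (hJ f hf i), map_zero, mul_zero]
    · rw [Set.singleton_subset_iff]
      change ψ (l - 1) = 0
      rw [map_sub, map_one, hψ hl, pow_one, hc, sub_self]
  have h0 : ψ f = 0 := hker h
  rw [hψ hf] at h0
  have h1 : θ f = 0 := by
    calc θ f = (c * θ l) ^ k * θ f := by rw [hc, one_pow, one_mul]
      _ = θ l ^ k * (c ^ k * θ f) := by ring
      _ = 0 := by rw [h0, mul_zero]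
  rw [hθ, IsLocalization.map_eq_zero_iff (Submonoid.powers (Ideal.Quotient.mk J l))] at h1
  obtain ⟨⟨_, m, rfl⟩, hm⟩ := h1
  refine ⟨m, Ideal.Quotient.eq_zero_iff_mem.mp ?_⟩
  simpa using hm

theorem mk_affineIdeal_self (J : Ideal (CoordRing K n)) (l : CoordRing K n) :
    Ideal.Quotient.mk (affineIdeal J l) l = 1 := by
  rw [← map_one (Ideal.Quotient.mk (affineIdeal J l)), Ideal.Quotient.eq]
  exact Ideal.mem_sup_right (Ideal.mem_span_singleton_self _)

/-- Every polynomial agrees with a form on the affine part `l = 1`. -/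
theorem exists_isHomogeneous_sub_mem_span {l : CoordRing K n} (hl : l.IsHomogeneous 1)
    (f : CoordRing K n) :
    ∃ (k : ℕ) (g : CoordRing K n), g.IsHomogeneous k ∧ f - g ∈ Ideal.span {l - 1} := by
  refine ⟨f.totalDegree, ∑ i ∈ Finset.range (f.totalDegree + 1),
    l ^ (f.totalDegree - i) * homogeneousComponent i f, ?_, ?_⟩
  · refine IsHomogeneous.sum _ _ _ fun i hi => ?_
    have := (hl.pow (f.totalDegree - i)).mul (homogeneousComponent_isHomogeneous i f)
    rwa [one_mul, Nat.sub_add_cancel (by rw [Finset.mem_range] at hi; omega)] at this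
  · have e : f - ∑ i ∈ Finset.range (f.totalDegree + 1),
        l ^ (f.totalDegree - i) * homogeneousComponent i f =
        ∑ i ∈ Finset.range (f.totalDegree + 1),
          (1 - l ^ (f.totalDegree - i)) * homogeneousComponent i f := by
      simp only [sub_mul, one_mul, Finset.sum_sub_distrib, sum_homogeneousComponent]
    rw [e]
    refine Ideal.sum_mem _ fun i _ => Ideal.mul_mem_right _ _ ?_
    rw [Ideal.mem_span_singleton, ← neg_sub (l ^ _), dvd_neg]
    exact sub_one_dvd_pow_sub_one l _

end Dehomogenization

/-! ### Comparison of Čech cohomology with the affine piece. -/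

section Gluing

variable {K : Type*} [Field K] {n : ℕ}

/-- Data witnessing that the linear form `l` is invertible on the subscheme defined by `J`: on the
chart `D₊(x_i)` the inverse of `l` is `(inv i) / x_i ^ (N + 1)`. -/
structure InvertibleForm (J : Ideal (CoordRing K n)) (l : CoordRing K n) where
  homogeneous : ∀ f ∈ J, ∀ m : ℕ, homogeneousComponent m f ∈ J
  isHomogeneous : l.IsHomogeneous 1
  /-- The exponent of the denominators. -/
  N : ℕ
  /-- The numerators. -/
  inv : Fin (n + 1) → CoordRing K n
  isHomogeneous_inv : ∀ i, (inv i).IsHomogeneous N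
  sub_mem : ∀ i, X i ^ (N + 1) - l * inv i ∈ J

/-- The hypothesis says that `l` has no zero on the subscheme. Raise all the relations to the common
exponent `∑ N i + 1` and take components of that degree. -/
theorem nonempty_invertibleForm {J : Ideal (CoordRing K n)}
    (hJ : ∀ f ∈ J, ∀ m : ℕ, homogeneousComponent m f ∈ J) {l : CoordRing K n}
    (hl : l.IsHomogeneous 1) (h : ∀ i, ∃ N : ℕ, X i ^ N ∈ J ⊔ Ideal.span {l}) :
    Nonempty (InvertibleForm J l) := by
  choose N hN using h
  have hN' : ∀ i, ∃ g : CoordRing K n, g.IsHomogeneous (∑ i, N i) ∧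
      X i ^ ((∑ i, N i) + 1) - l * g ∈ J := by
    intro i
    have h1 : X i ^ ((∑ i, N i) + 1) ∈ J ⊔ Ideal.span {l} := by
      obtain ⟨c, hc⟩ := Nat.exists_eq_add_of_le (show N i ≤ (∑ i, N i) + 1 from
        (Finset.single_le_sum (fun _ _ => Nat.zero_le _) (Finset.mem_univ i)).trans (by omega))
      rw [hc, pow_add]
      exact Ideal.mul_mem_right _ _ (hN i)
    obtain ⟨f, hf, g, hg, e⟩ := Submodule.mem_sup.mp h1
    obtain ⟨g, rfl⟩ := Ideal.mem_span_singleton'.mp hg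
    refine ⟨homogeneousComponent (∑ i, N i) g, homogeneousComponent_isHomogeneous _ _, ?_⟩
    have h2 := hJ f hf ((∑ i, N i) + 1)
    rw [eq_sub_of_add_eq e, map_sub, homogeneousComponent_mul_of_isHomogeneous hl,
      homogeneousComponent_eq_self (by simpa using (isHomogeneous_X K i).pow _), mul_comm] at h2
    exact h2
  choose g hg hgJ using hN'
  exact ⟨⟨hJ, hl, _, g, hg, hgJ⟩⟩

/-- Families of sections of `𝓞(q)` over the `D₊(x_i)` that agree modulo `𝓙` on the overlaps. -/
def twistedCocycles (J : Ideal (CoordRing K n)) (q : ℕ) :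
    Submodule K (Fin (n + 1) → Frac K n) where
  carrier := {s | (∀ i, s i ∈ sections ⊤ q (chart i)) ∧
    ∀ i j, s j - s i ∈ sections J q (overlap i j)}
  zero_mem' := ⟨fun _ => Submodule.zero_mem _, fun _ _ => by simp⟩
  add_mem' := by
    rintro s t ⟨hs, hs'⟩ ⟨ht, ht'⟩
    refine ⟨fun i => Submodule.add_mem _ (hs i) (ht i), fun i j => ?_⟩
    have h := Submodule.add_mem _ (hs' i j) (ht' i j)
    rwa [show s j - s i + (t j - t i) = (s + t) j - (s + t) i by simp; ring] at h
  smul_mem' := by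
    rintro c s ⟨hs, hs'⟩
    refine ⟨fun i => Submodule.smul_mem _ c (hs i), fun i j => ?_⟩
    have h := Submodule.smul_mem _ c (hs' i j)
    rwa [smul_sub] at h

/-- A partition of unity `∑ c j * a j ^ k = 1` glues the local fractions `φ j / a j ^ k` to `∑ c j *
φ j`. -/
theorem exists_forall_pow_mul_eq {A : Type*} [CommRing A] {ι : Type*} [Fintype ι] {a φ : ι → A}
    (ha : Ideal.span (Set.range a) = ⊤) {k : ℕ} (h : ∀ i j, φ j * a i ^ k = φ i * a j ^ k) :
    ∃ α : A, ∀ i, a i ^ k * α = φ i := by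
  have h1 := Ideal.span_pow_eq_top _ ha k
  rw [← Set.range_comp, Ideal.eq_top_iff_one, Ideal.mem_span_range_iff_exists_fun] at h1
  obtain ⟨c, hc⟩ := h1
  refine ⟨∑ j, c j * φ j, fun i => ?_⟩
  calc a i ^ k * ∑ j, c j * φ j = ∑ j, c j * (φ j * a i ^ k) := by
        rw [Finset.mul_sum]
        exact Finset.sum_congr rfl fun j _ => by ring
    _ = φ i * ∑ j, c j * a j ^ k := by
        rw [Finset.mul_sum]
        exact Finset.sum_congr rfl fun j _ => by rw [h i j]; ring
    _ = φ i := by rw [show ∑ j, c j * a j ^ k = 1 from hc, mul_one]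

theorem span_range_mk_X_eq_top {l : CoordRing K n} (hl : l.IsHomogeneous 1)
    (J : Ideal (CoordRing K n)) :
    Ideal.span (Set.range fun i => Ideal.Quotient.mk (affineIdeal J l) (X i)) = ⊤ := by
  rw [Ideal.eq_top_iff_one, ← mk_affineIdeal_self J l]
  have h : l ∈ Submodule.span K (Set.range (X : Fin (n + 1) → CoordRing K n)) := by
    rw [← homogeneousSubmodule_one_eq_span_X]
    exact hl
  have h2 : l ∈ Ideal.span (Set.range (X : Fin (n + 1) → CoordRing K n)) :=
    Submodule.span_le_restrictScalars K (CoordRing K n) _ h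
  have h3 := Ideal.mem_map_of_mem (Ideal.Quotient.mk (affineIdeal J l)) h2
  rwa [Ideal.map_span, ← Set.range_comp] at h3

namespace InvertibleForm

variable {J : Ideal (CoordRing K n)} {l : CoordRing K n} (D : InvertibleForm J l)

theorem mk_X_pow (i : Fin (n + 1)) (e : ℕ) :
    Ideal.Quotient.mk J (X i) ^ ((D.N + 1) * e) =
      Ideal.Quotient.mk J l ^ e * Ideal.Quotient.mk J (D.inv i) ^ e := by
  have h := Ideal.Quotient.eq.mpr (D.sub_mem i)
  rw [map_pow, map_mul] at h
  rw [pow_mul, h, mul_pow]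

/-- The inverse of `l` on the chart `D₊(x_i)`, up to elements of the ideal sheaf. -/
def fracInv (i : Fin (n + 1)) : Frac K n :=
  toFrac K n (D.inv i) / toFrac K n (X i) ^ (D.N + 1)

theorem fracInv_pow_mul (i : Fin (n + 1)) (e : ℕ) :
    D.fracInv i ^ e * toFrac K n (X i) ^ ((D.N + 1) * e) = toFrac K n (D.inv i) ^ e := by
  rw [pow_mul, ← mul_pow, fracInv, div_mul_cancel₀ _ (pow_ne_zero _ (toFrac_X_ne_zero i))]

/-- The family of sections of `𝓞(q)` representing `l ^ q * f(x / l)`. -/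
def glue (q : ℕ) : CoordRing K n →ₗ[K] (Fin (n + 1) → Frac K n) :=
  LinearMap.pi fun i => LinearMap.mulLeft K (toFrac K n l ^ q) ∘ₗ
    (aeval fun j => D.fracInv i * toFrac K n (X j)).toLinearMap

theorem glue_apply (q : ℕ) {f : CoordRing K n} {e : ℕ} (hf : f.IsHomogeneous e)
    (i : Fin (n + 1)) :
    D.glue q f i = toFrac K n l ^ q * (D.fracInv i ^ e * toFrac K n f) := by
  change toFrac K n l ^ q * aeval (fun j => D.fracInv i * toFrac K n (X j)) f = _
  rw [aeval_mul_of_isHomogeneous hf]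
  congr 2
  exact (DFunLike.congr_fun (aeval_unique (toFrac K n)) f).symm

theorem glue_apply_mul (q : ℕ) {f : CoordRing K n} {e : ℕ} (hf : f.IsHomogeneous e)
    (i : Fin (n + 1)) :
    D.glue q f i * toFrac K n (X i) ^ ((D.N + 1) * e) = toFrac K n (l ^ q * f * D.inv i ^ e) := by
  rw [D.glue_apply q hf, map_mul, map_mul, map_pow, map_pow, ← D.fracInv_pow_mul]
  ring

theorem glue_eq_sum (q : ℕ) (f : CoordRing K n) :
    D.glue q f = ∑ e ∈ Finset.range (f.totalDegree + 1), D.glue q (homogeneousComponent e f) := by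
  rw [← map_sum, sum_homogeneousComponent]

theorem glue_mem_sections_top (q : ℕ) (f : CoordRing K n) (i : Fin (n + 1)) :
    D.glue q f i ∈ sections ⊤ q (chart i) := by
  rw [D.glue_eq_sum, Finset.sum_apply]
  refine Submodule.sum_mem _ fun e _ => ?_
  have hf := homogeneousComponent_isHomogeneous e f
  rw [mem_sections_chart]
  refine ⟨_, _, trivial, ?_, D.glue_apply_mul q hf i⟩
  have := ((D.isHomogeneous.pow q).mul hf).mul ((D.isHomogeneous_inv i).pow e)
  rwa [show 1 * q + e + D.N * e = q + (D.N + 1) * e by ring] at this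

/-- On an overlap the two local inverses of `l` agree modulo `J` once multiplied by powers of `x_i`
and `x_j`, because `x_i ^ (N + 1) ≡ l * inv i`. -/
theorem glue_mem_twistedCocycles (q : ℕ) (f : CoordRing K n) :
    D.glue q f ∈ twistedCocycles J q := by
  refine ⟨D.glue_mem_sections_top q f, fun i j => ?_⟩
  rw [D.glue_eq_sum, Finset.sum_apply, Finset.sum_apply, ← Finset.sum_sub_distrib]
  refine Submodule.sum_mem _ fun e _ => ?_
  have hf := homogeneousComponent_isHomogeneous e f
  set g := homogeneousComponent e f
  have hm : toFrac K n (monomial (overlap i j) (1 : K)) =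
      toFrac K n (X i) * toFrac K n (X j) := by
    rw [← map_mul]
    congr 1
    simp [overlap, chart, X, monomial_mul]
  refine mem_sections_of_mul_mem (k := (D.N + 1) * e)
    (f := l ^ q * g * D.inv j ^ e * X i ^ ((D.N + 1) * e) -
      l ^ q * g * D.inv i ^ e * X j ^ ((D.N + 1) * e))
    (Submodule.sub_mem _ (sections_chart_le_overlap_right q i j (D.glue_mem_sections_top q g j))
      (sections_chart_le_overlap_left q i j (D.glue_mem_sections_top q g i))) ?_ ?_
  · rw [← Ideal.Quotient.eq_zero_iff_mem]
    simp only [map_sub, map_mul, map_pow, D.mk_X_pow]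
    ring
  · rw [hm, map_sub, map_mul _ _ (X i ^ _), map_mul _ _ (X j ^ _), ← D.glue_apply_mul q hf,
      ← D.glue_apply_mul q hf, map_pow, map_pow]
    ring

theorem glue_mem_sections_of_mem (q : ℕ) {f : CoordRing K n} (hf : f ∈ affineIdeal J l)
    (i : Fin (n + 1)) : D.glue q f i ∈ sections J q (chart i) := by
  obtain ⟨g, hg, h, hh, rfl⟩ := Submodule.mem_sup.mp hf
  rw [map_add]
  refine Submodule.add_mem _ ?_ ?_
  · rw [D.glue_eq_sum, Finset.sum_apply]
    refine Submodule.sum_mem _ fun e _ => ?_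
    refine mem_sections_of_mul_mem (D.glue_mem_sections_top q _ i)
      (Ideal.mul_mem_right _ _ (J.mul_mem_left _ (D.homogeneous g hg e)))
      (D.glue_apply_mul q (homogeneousComponent_isHomogeneous e g) i)
  · obtain ⟨c, rfl⟩ := Ideal.mem_span_singleton'.mp hh
    rw [← sum_homogeneousComponent c, Finset.sum_mul, map_sum, Finset.sum_apply]
    refine Submodule.sum_mem _ fun e _ => ?_
    have hc := homogeneousComponent_isHomogeneous e c
    set c' := homogeneousComponent e c
    refine mem_sections_of_mul_mem (D.glue_mem_sections_top q _ i) (k := (D.N + 1) * (e + 1))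
      (f := l ^ q * (c' * l) * D.inv i ^ (e + 1) -
        l ^ q * c' * D.inv i ^ e * X i ^ ((D.N + 1) * 1)) ?_ ?_
    · rw [← Ideal.Quotient.eq_zero_iff_mem]
      simp only [map_sub, map_mul, map_pow, D.mk_X_pow]
      ring
    · change _ * toFrac K n (X i) ^ _ = _
      rw [mul_sub, mul_one, map_sub, Pi.sub_apply, map_sub, map_mul (toFrac K n) _ (X i ^ _),
        ← D.glue_apply_mul q hc, ← D.glue_apply_mul q (hc.mul D.isHomogeneous), map_pow]
      ring

/-- Replace `f` by a form `g` that agrees with it where `l = 1`. Clearing denominators on each chart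
puts a power of `x_i` times `l ^ q * g` into `J`; at `l = 1` powers of all the `x_i` kill `g`, and
the `x_i` generate the unit ideal. -/
theorem mem_affineIdeal_of_glue_mem (q : ℕ) {f : CoordRing K n}
    (hf : ∀ i, D.glue q f i ∈ sections J q (chart i)) : f ∈ affineIdeal J l := by
  obtain ⟨e, g, hg, hfg⟩ := exists_isHomogeneous_sub_mem_span D.isHomogeneous f
  have hfg' : f - g ∈ affineIdeal J l := Ideal.mem_sup_right hfg
  suffices g ∈ affineIdeal J l by simpa using Ideal.add_mem _ hfg' this
  have hgs : ∀ i, D.glue q g i ∈ sections J q (chart i) := by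
    intro i
    have h1 := D.glue_mem_sections_of_mem q hfg' i
    have h2 := Submodule.sub_mem _ (hf i) h1
    rwa [map_sub, Pi.sub_apply, sub_sub_cancel] at h2
  have hann : ∀ i, ∃ m, Ideal.Quotient.mk (affineIdeal J l) (X i) ^ m *
      Ideal.Quotient.mk (affineIdeal J l) g = 0 := by
    intro i
    obtain ⟨k, h, hh, -, e1⟩ := mem_sections_chart.mp (hgs i)
    have e2 : X i ^ k * (l ^ q * g * D.inv i ^ e) = h * X i ^ ((D.N + 1) * e) := by
      apply toFrac_injective
      rw [map_mul, map_mul _ h, ← e1, ← D.glue_apply_mul q hg, map_pow, map_pow]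
      ring
    have h3 : X i ^ k * (l ^ q * g) * X i ^ ((D.N + 1) * e) ∈ J := by
      rw [← Ideal.Quotient.eq_zero_iff_mem]
      have e3 := congrArg (Ideal.Quotient.mk J) e2
      rw [map_mul _ h, Ideal.Quotient.eq_zero_iff_mem.mpr hh, zero_mul] at e3
      simp only [map_mul, map_pow, D.mk_X_pow] at e3 ⊢
      linear_combination Ideal.Quotient.mk J l ^ e * e3
    have h4 := Ideal.Quotient.eq_zero_iff_mem.mpr
      ((le_sup_left : J ≤ affineIdeal J l) h3)
    simp only [map_mul, map_pow, mk_affineIdeal_self, one_pow, one_mul] at h4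
    exact ⟨k + (D.N + 1) * e, by rw [← h4]; ring⟩
  choose m hm using hann
  rw [← Ideal.Quotient.eq_zero_iff_mem]
  set y := Ideal.Quotient.mk (affineIdeal J l) g
  have h1 := Ideal.span_pow_eq_top _ (span_range_mk_X_eq_top D.isHomogeneous J) (∑ i, m i)
  have h2 : Ideal.span ((fun x => x ^ (∑ i, m i)) ''
      Set.range fun i => Ideal.Quotient.mk (affineIdeal J l) (X i)) ≤
      LinearMap.ker (LinearMap.mulRight (CoordRing K n ⧸ affineIdeal J l) y) := by
    rw [Ideal.span_le]
    rintro _ ⟨_, ⟨i, rfl⟩, rfl⟩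
    obtain ⟨c, hc⟩ := Nat.exists_eq_add_of_le
      (Finset.single_le_sum (f := m) (fun _ _ => Nat.zero_le _) (Finset.mem_univ i))
    change _ * y = 0
    simp only
    rw [hc, pow_add, mul_comm (_ ^ m i), mul_assoc, hm, mul_zero]
  rw [h1] at h2
  simpa using h2 (x := 1) trivial

/-- At `l = 1` the numerators of the `s i` glue to a single function, represented by a form `g`. The
comparison of `g` with each numerator is then homogenized by powers of `l`, and
`exists_pow_mul_mem_of_mem_affineIdeal` brings it back into `J`. -/
theorem exists_glue_sub_mem (q : ℕ) {s : Fin (n + 1) → Frac K n} (hs : s ∈ twistedCocycles J q) :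
    ∃ f, ∀ i, D.glue q f i - s i ∈ sections J q (chart i) := by
  obtain ⟨hs₁, hs₂⟩ := hs
  have hev : ∀ᶠ k : ℕ in Filter.atTop,
      (∀ i, ∃ f : CoordRing K n, f.IsHomogeneous (q + k) ∧
        s i * toFrac K n (X i) ^ k = toFrac K n f) ∧
      ∀ i j, ∃ h ∈ J, (s j - s i) * (toFrac K n (X i) * toFrac K n (X j)) ^ k = toFrac K n h := by
    rw [Filter.eventually_and]
    refine ⟨Filter.eventually_all.mpr fun i => ?_,
      Filter.eventually_all.mpr fun i => Filter.eventually_all.mpr fun j => ?_⟩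
    · filter_upwards [eventually_of_mem_sections (hs₁ i)] with k hk
      obtain ⟨f, -, hf, h⟩ := hk
      exact ⟨f, by simpa using hf, h⟩
    · filter_upwards [eventually_of_mem_sections (hs₂ i j)] with k hk
      obtain ⟨f, hfJ, hf, h⟩ := hk
      refine ⟨f, hfJ, ?_⟩
      rw [← h, ← map_mul]
      congr 3
      simp [overlap, chart, X, monomial_mul]
  obtain ⟨k, h₁, h₂⟩ := hev.exists
  choose f hf hsf using h₁
  have hrel : ∀ i j, f j * X i ^ k - f i * X j ^ k ∈ J := by
    intro i j
    obtain ⟨h, hh, e⟩ := h₂ i j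
    rwa [show f j * X i ^ k - f i * X j ^ k = h by
      apply toFrac_injective
      rw [← e, map_sub, map_mul, map_mul, ← hsf, ← hsf, map_pow, map_pow]
      ring]
  obtain ⟨α, hα⟩ := exists_forall_pow_mul_eq (k := k)
    (φ := fun i => Ideal.Quotient.mk (affineIdeal J l) (f i))
    (span_range_mk_X_eq_top D.isHomogeneous J) (fun i j => by
      rw [← map_pow, ← map_pow, ← map_mul, ← map_mul, Ideal.Quotient.eq]
      exact Ideal.mem_sup_left (hrel i j))
  obtain ⟨g₀, rfl⟩ := Ideal.Quotient.mk_surjective α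
  obtain ⟨e, g, hg, hgg⟩ := exists_isHomogeneous_sub_mem_span D.isHomogeneous g₀
  rw [Ideal.Quotient.eq.mpr (Ideal.mem_sup_right hgg : g₀ - g ∈ affineIdeal J l)] at hα
  refine ⟨g, fun i => ?_⟩
  have hP : X i ^ k * g * l ^ q - f i * l ^ e ∈ affineIdeal J l := by
    rw [← Ideal.Quotient.eq_zero_iff_mem]
    simp only [map_sub, map_mul, map_pow, mk_affineIdeal_self, one_pow, mul_one, hα, sub_self]
  have hPh : (X i ^ k * g * l ^ q - f i * l ^ e).IsHomogeneous (q + k + e) := by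
    refine IsHomogeneous.sub ?_ ?_
    · have := (((isHomogeneous_X K i).pow k).mul hg).mul (D.isHomogeneous.pow q)
      rwa [show 1 * k + e + 1 * q = q + k + e by ring] at this
    · simpa using (hf i).mul (D.isHomogeneous.pow e)
  obtain ⟨p, hp⟩ := exists_pow_mul_mem_of_mem_affineIdeal D.homogeneous D.isHomogeneous hPh hP
  refine mem_sections_of_mul_mem (Submodule.sub_mem _ (D.glue_mem_sections_top q g i) (hs₁ i))
    (k := (D.N + 1) * e + (k + (D.N + 1) * p))
    (f := l ^ q * g * D.inv i ^ e * (X i ^ k * X i ^ ((D.N + 1) * p)) -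
      f i * (X i ^ ((D.N + 1) * e) * X i ^ ((D.N + 1) * p))) ?_ ?_
  · rw [← Ideal.Quotient.eq_zero_iff_mem] at hp ⊢
    simp only [map_sub, map_mul, map_pow, D.mk_X_pow] at hp ⊢
    linear_combination Ideal.Quotient.mk J (D.inv i) ^ e * Ideal.Quotient.mk J (D.inv i) ^ p * hp
  · change _ * toFrac K n (X i) ^ _ = _
    rw [map_sub, map_mul _ (l ^ q * g * _), map_mul _ (f i), ← D.glue_apply_mul q hg, ← hsf]
    simp only [map_mul, map_pow, pow_add]
    ring

/-- The global sections of the structure sheaf are the coordinate ring of the affine part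
`l = 1`. -/
theorem length_eq (D : InvertibleForm J l) :
    length J = Module.length K (CoordRing K n ⧸ affineIdeal J l) := by
  let Ψ : CoordRing K n →ₗ[K] StructureSections J :=
    ((quotientTrivial J).submoduleOf (quotientCocycles J)).mkQ ∘ₗ
      (D.glue 0).codRestrict (quotientCocycles J) (D.glue_mem_twistedCocycles 0)
  have hker : LinearMap.ker Ψ = (affineIdeal J l).restrictScalars K := by
    ext f
    have h1 : f ∈ LinearMap.ker Ψ ↔ D.glue 0 f ∈ quotientTrivial J := by
      rw [LinearMap.mem_ker]
      exact Submodule.Quotient.mk_eq_zero _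
    have h2 : D.glue 0 f ∈ quotientTrivial J ↔ ∀ i, D.glue 0 f i ∈ sections J 0 (chart i) := by
      simp [quotientTrivial, Submodule.mem_pi]
    rw [h1, h2]
    exact ⟨D.mem_affineIdeal_of_glue_mem 0, fun h => D.glue_mem_sections_of_mem 0 h⟩
  have hsurj : Function.Surjective Ψ := by
    intro y
    obtain ⟨⟨s, hs⟩, rfl⟩ := Submodule.Quotient.mk_surjective _ y
    obtain ⟨f, hf⟩ := D.exists_glue_sub_mem 0 hs
    refine ⟨f, (Submodule.Quotient.eq _).mpr ?_⟩
    change D.glue 0 f - s ∈ quotientTrivial J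
    simpa [quotientTrivial, Submodule.mem_pi] using hf
  have h1 := (Ψ.quotKerEquivOfSurjective hsurj).length_eq
  rw [hker] at h1
  rw [length, ← h1]
  exact (Submodule.Quotient.restrictScalarsEquiv K (affineIdeal J l)).length_eq

/-- For a form of degree `q` the expression `l ^ q * f (x / l)` is `f` itself. -/
theorem glue_sub_mem (q : ℕ) {f : CoordRing K n} (hf : f.IsHomogeneous q) (i : Fin (n + 1)) :
    D.glue q f i - toFrac K n f ∈ sections J q (chart i) := by
  refine mem_sections_of_mul_mem (Submodule.sub_mem _ (D.glue_mem_sections_top q f i)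
    (mem_sections_chart.mpr ⟨0, f, trivial, hf, by simp⟩)) (k := (D.N + 1) * q)
    (f := l ^ q * f * D.inv i ^ q - f * X i ^ ((D.N + 1) * q)) ?_ ?_
  · rw [← Ideal.Quotient.eq_zero_iff_mem]
    simp only [map_sub, map_mul, map_pow, D.mk_X_pow]
    ring
  · change _ * toFrac K n (X i) ^ _ = _
    rw [sub_mul, D.glue_apply_mul q hf, map_sub, map_mul _ f, map_pow]

/-- `H¹(ℙⁿ, 𝓙(q))` is the cokernel of the restriction of the forms of degree `q` to the
subscheme. -/
theorem h1_eq (D : InvertibleForm J l) (hn : 2 ≤ n) (q : ℕ) :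
    h1 J q = Module.length K ((CoordRing K n) ⧸
      ((affineIdeal J l).restrictScalars K ⊔ homogeneousSubmodule (Fin (n + 1)) K q)) := by
  let δ : (Fin (n + 1) → Frac K n) →ₗ[K] (Fin (n + 1) → Fin (n + 1) → Frac K n) :=
    LinearMap.pi fun i => LinearMap.pi fun j => LinearMap.proj (R := K) (φ := fun _ => Frac K n) j -
      LinearMap.proj (R := K) (φ := fun _ => Frac K n) i
  have hδ : ∀ b i j, δ b i j = b j - b i := fun b i j => rfl
  let Ψ : CoordRing K n →ₗ[K] H1 J q :=
    ((coboundaries J q).submoduleOf (cocycles J q)).mkQ ∘ₗ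
      (δ ∘ₗ D.glue q).codRestrict (cocycles J q) fun f =>
        ⟨(D.glue_mem_twistedCocycles q f).2, fun i j k => by simp [hδ]⟩
  have hker : LinearMap.ker Ψ =
      (affineIdeal J l).restrictScalars K ⊔ homogeneousSubmodule (Fin (n + 1)) K q := by
    ext f
    have h1 : f ∈ LinearMap.ker Ψ ↔ δ (D.glue q f) ∈ coboundaries J q := by
      rw [LinearMap.mem_ker]
      exact Submodule.Quotient.mk_eq_zero _
    rw [h1]
    constructor
    · rintro ⟨b, hb, e⟩
      -- Correcting by `b` leaves the same fraction on every chart: a global section of `𝓞(q)`,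
      -- hence a form of degree `q`.
      have hconst : ∀ i, D.glue q f i - b i = D.glue q f 0 - b 0 := by
        intro i
        have := e 0 i
        rw [hδ] at this
        linear_combination this
      obtain ⟨h, hh, e'⟩ := exists_form_of_forall_mem_sections (by omega)
        (q := q) (z := D.glue q f 0 - b 0) (fun i => by
          rw [← hconst i]
          exact Submodule.sub_mem _ (D.glue_mem_sections_top q f i)
            (sections_le_top J q _ (hb i)))
      have h2 : f - h ∈ affineIdeal J l := by
        refine D.mem_affineIdeal_of_glue_mem q fun i => ?_
        have h3 := Submodule.sub_mem _ (hb i) (D.glue_sub_mem q hh i)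
        rw [← e', ← hconst i] at h3
        rw [map_sub, Pi.sub_apply]
        convert h3 using 1
        ring
      rw [← sub_add_cancel f h]
      exact Submodule.add_mem_sup h2 hh
    · intro hf
      obtain ⟨g, hg, h, hh, rfl⟩ := Submodule.mem_sup.mp hf
      refine ⟨fun i => D.glue q g i + (D.glue q h i - toFrac K n h), fun i =>
        Submodule.add_mem _ (D.glue_mem_sections_of_mem q hg i) (D.glue_sub_mem q hh i), ?_⟩
      intro i j
      rw [hδ, map_add, Pi.add_apply, Pi.add_apply]
      ring
  have hsurj : Function.Surjective Ψ := by
    intro y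
    obtain ⟨⟨c, hc, hcc⟩, rfl⟩ := Submodule.Quotient.mk_surjective _ y
    -- A cocycle of `𝓙(q)` bounds in `𝓞(q)`, and the bounding family agrees modulo `𝓙` on overlaps,
    -- so it comes from the affine piece.
    obtain ⟨b, hb, e⟩ := exists_eq_sub_of_cocycle hn
      (fun i j => sections_le_top J q _ (hc i j)) hcc
    obtain ⟨f, hf⟩ := D.exists_glue_sub_mem q (s := b) ⟨hb, fun i j => e i j ▸ hc i j⟩
    refine ⟨f, (Submodule.Quotient.eq _).mpr ?_⟩
    refine ⟨fun i => D.glue q f i - b i, hf, fun i j => ?_⟩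
    change δ (D.glue q f) i j - c i j = _
    rw [e, hδ]
    ring
  have h1 := (Ψ.quotKerEquivOfSurjective hsurj).length_eq
  rw [hker] at h1
  rw [ProjSpace.h1, ← h1]

end InvertibleForm

end Gluing

/-! ### A hyperplane disjoint from a finite subscheme. -/

section AvoidingHyperplane

variable {K : Type*} [Field K] {n : ℕ}

/-- The powers of `x_j / x_i` are dependent in the finite-dimensional coordinate ring of the chart,
and a relation among them restricts the `j`-th coordinate of each point. -/
theorem ClosedSubscheme.IsFinite.exists_polynomial {Γ : ClosedSubscheme K n} (hΓ : Γ.IsFinite)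
    (i j : Fin (n + 1)) :
    ∃ P : Polynomial K, P ≠ 0 ∧ ∀ x : Fin (n + 1) → K, x i = 1 →
      (∀ f ∈ Γ.ideal, eval x f = 0) → P.IsRoot (x j) := by
  have := hΓ i
  let t : Frac K n := toFrac K n (X j) / toFrac K n (X i)
  have ht : ∀ P : Polynomial K, Polynomial.aeval t P * toFrac K n (X i) ^ P.natDegree =
      toFrac K n (∑ m ∈ Finset.range (P.natDegree + 1),
        C (P.coeff m) * (X j ^ m * X i ^ (P.natDegree - m))) := by
    intro P
    rw [Polynomial.aeval_eq_sum_range, Finset.sum_mul, map_sum]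
    refine Finset.sum_congr rfl fun m hm => ?_
    have hmd : m ≤ P.natDegree := by
      rw [Finset.mem_range] at hm
      omega
    obtain ⟨c, hc⟩ := Nat.exists_eq_add_of_le hmd
    rw [map_mul, map_mul, map_pow, map_pow, hc, Nat.add_sub_cancel_left, pow_add,
      ← MvPolynomial.algebraMap_eq, AlgHom.commutes, Algebra.smul_def, div_pow]
    have h0 := pow_ne_zero m (toFrac_X_ne_zero (K := K) i)
    field_simp
  have hmem : ∀ P : Polynomial K, (Polynomial.aeval t).toLinearMap P ∈
      sections (⊤ : Ideal (CoordRing K n)) 0 (chart i) := by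
    intro P
    refine mem_sections_chart.mpr ⟨P.natDegree, _, trivial, ?_, ht P⟩
    refine IsHomogeneous.sum _ _ _ fun m hm => ?_
    have hmd : m ≤ P.natDegree := by
      rw [Finset.mem_range] at hm
      omega
    have := (((isHomogeneous_X K j).pow m).mul
      ((isHomogeneous_X K i).pow (P.natDegree - m))).C_mul (P.coeff m)
    rwa [show 1 * m + 1 * (P.natDegree - m) = 0 + P.natDegree by omega] at this
  let Φ : Polynomial K →ₗ[K] (sections (⊤ : Ideal (CoordRing K n)) 0 (chart i) ⧸
      (sections Γ.ideal 0 (chart i)).submoduleOf (sections ⊤ 0 (chart i))) :=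
    Submodule.mkQ _ ∘ₗ (Polynomial.aeval t).toLinearMap.codRestrict _ hmem
  have hΦ : ¬ Function.Injective Φ := fun h =>
    Polynomial.not_finite (R := K) (Module.Finite.of_injective Φ h)
  rw [← LinearMap.ker_eq_bot, ← Ne, Submodule.ne_bot_iff] at hΦ
  obtain ⟨P, hP, hP0⟩ := hΦ
  refine ⟨P, hP0, fun x hxi hx => ?_⟩
  have hPI : Polynomial.aeval t P ∈ sections Γ.ideal 0 (chart i) := by
    rw [LinearMap.mem_ker] at hP
    exact (Submodule.Quotient.mk_eq_zero
      ((sections Γ.ideal 0 (chart i)).submoduleOf (sections ⊤ 0 (chart i)))).mp hP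
  obtain ⟨k, f, hf, -, e⟩ := mem_sections_chart.mp hPI
  have e2 : (∑ m ∈ Finset.range (P.natDegree + 1),
      C (P.coeff m) * (X j ^ m * X i ^ (P.natDegree - m))) * X i ^ k =
      f * X i ^ P.natDegree := by
    apply toFrac_injective
    rw [map_mul, map_mul _ f, ← ht, ← e, map_pow, map_pow]
    ring
  have e3 := congrArg (eval x) e2
  simp only [map_mul, map_sum, map_pow, eval_X, eval_C, hxi, one_pow, mul_one, hx f hf] at e3
  rw [Polynomial.IsRoot, Polynomial.eval_eq_sum_range]
  exact e3

theorem ClosedSubscheme.IsFinite.finite_chart {Γ : ClosedSubscheme K n} (hΓ : Γ.IsFinite)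
    (i : Fin (n + 1)) :
    {x : Fin (n + 1) → K | x i = 1 ∧ ∀ f ∈ Γ.ideal, eval x f = 0}.Finite := by
  choose P hP0 hP using hΓ.exists_polynomial i
  refine (Set.Finite.pi' fun j => Polynomial.finite_setOfPred_isRoot (hP0 j)).subset ?_
  rintro x ⟨hxi, hx⟩ j
  exact hP j x hxi hx

/-- The forms vanishing at one point are a proper subspace, and finitely many proper subspaces do
not cover a space over an infinite field. -/
theorem exists_linear_form_ne_zero [Infinite K] {s : Set (Fin (n + 1) → K)} (hs : s.Finite)
    (h0 : ∀ x ∈ s, x ≠ 0) :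
    ∃ l : CoordRing K n, l.IsHomogeneous 1 ∧ ∀ x ∈ s, eval x l ≠ 0 := by
  classical
  let H : (Fin (n + 1) → K) → Submodule K (Fin (n + 1) → K) := fun x =>
    LinearMap.ker (Fintype.linearCombination K (fun j => x j) : (Fin (n + 1) → K) →ₗ[K] K)
  have hH : ∀ x c, c ∈ H x ↔ ∑ j, c j * x j = 0 := by
    intro x c
    rw [LinearMap.mem_ker, Fintype.linearCombination_apply]
    simp [smul_eq_mul]
  have htop : (⊤ : Subspace K (Fin (n + 1) → K)) ∉ hs.toFinset.image H := by
    rw [Finset.mem_image]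
    rintro ⟨x, hx, e⟩
    refine h0 x (by simpa using hx) (funext fun j => ?_)
    have : Pi.single j 1 ∈ H x := e ▸ Submodule.mem_top
    rw [hH] at this
    simpa [Pi.single_apply] using this
  obtain ⟨c, hc⟩ := (Set.ne_univ_iff_exists_notMem _).mp
    (Subspace.biUnion_ne_univ_of_top_notMem htop)
  refine ⟨∑ j, C (c j) * X j, ?_, fun x hx h => hc ?_⟩
  · exact IsHomogeneous.sum _ _ _ fun j _ => by
      simpa using (isHomogeneous_X K j).C_mul (c j)
  · refine Set.mem_iUnion₂.mpr ⟨H x, Finset.mem_image_of_mem _ (by simpa using hx), ?_⟩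
    rw [SetLike.mem_coe, hH]
    simpa using h

theorem ClosedSubscheme.eval_smul_eq_zero (Γ : ClosedSubscheme K n) {x : Fin (n + 1) → K}
    (hx : ∀ f ∈ Γ.ideal, eval x f = 0) (c : K) : ∀ f ∈ Γ.ideal, eval (c • x) f = 0 := by
  intro f hf
  rw [← sum_homogeneousComponent f, map_sum]
  refine Finset.sum_eq_zero fun i _ => ?_
  rw [eval_smul_of_isHomogeneous (homogeneousComponent_isHomogeneous i f),
    hx _ (Γ.homogeneous f hf i), mul_zero]

/-- A hyperplane that misses a finite subscheme. -/
theorem ClosedSubscheme.IsFinite.exists_invertibleForm [IsAlgClosed K] {Γ : ClosedSubscheme K n}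
    (hΓ : Γ.IsFinite) : ∃ l, Nonempty (InvertibleForm Γ.ideal l) := by
  have : Infinite K := IsAlgClosed.instInfinite
  obtain ⟨l, hl, hl0⟩ := exists_linear_form_ne_zero
    (Set.finite_iUnion fun i => hΓ.finite_chart i) (by
      intro x hx
      obtain ⟨i, hi, -⟩ := Set.mem_iUnion.mp hx
      rintro rfl
      simp at hi)
  refine ⟨l, nonempty_invertibleForm Γ.homogeneous hl fun i => ?_⟩
  -- By the Nullstellensatz it suffices that `x_i` vanishes at every common zero of the ideal and
  -- `l`; otherwise rescaling to `x_i = 1` gives a chart point at which `l` was chosen nonzero.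
  change X i ∈ (Γ.ideal ⊔ Ideal.span {l}).radical
  rw [← vanishingIdeal_zeroLocus_eq_radical (K := K)]
  intro x hx
  rw [aeval_X]
  by_contra hxi
  have hx' : ∀ f ∈ Γ.ideal, eval x f = 0 := fun f hf => by
    simpa using hx f (Ideal.mem_sup_left hf)
  have hxl : eval x l = 0 := by
    simpa using hx l (Ideal.mem_sup_right (Ideal.mem_span_singleton_self l))
  refine hl0 ((x i)⁻¹ • x) (Set.mem_iUnion.mpr ⟨i, ?_, Γ.eval_smul_eq_zero hx' _⟩) ?_
  · simp [hxi]
  · rw [eval_smul_of_isHomogeneous hl, hxl, mul_zero]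

end AvoidingHyperplane

/-! ### Hilbert function, `h¹` and linear position in the affine model. -/

section AffineModel

variable {K : Type*} [Field K] {n : ℕ}

/-- The coordinate ring of the affine part `l = 1` of the cone defined by `J`. -/
abbrev AffineRing (J : Ideal (CoordRing K n)) (l : CoordRing K n) : Type _ :=
  CoordRing K n ⧸ affineIdeal J l

/-- The projection to the coordinate ring of the affine part. -/
abbrev toAffine (J : Ideal (CoordRing K n)) (l : CoordRing K n) :
    CoordRing K n →ₐ[K] AffineRing J l :=
  Ideal.Quotient.mkₐ K (affineIdeal J l)

/-- The restrictions of the linear forms to the affine part `l = 1`. -/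
abbrev linearForms (J : Ideal (CoordRing K n)) (l : CoordRing K n) :
    Submodule K (AffineRing J l) :=
  (homogeneousSubmodule (Fin (n + 1)) K 1).map (toAffine J l).toLinearMap

instance finite_homogeneousSubmodule (k : ℕ) :
    Module.Finite K (homogeneousSubmodule (Fin (n + 1)) K k) :=
  Module.Finite.iff_fg.mpr (homogeneousSubmodule_fg _ _ _)

theorem finrank_homogeneousSubmodule_one :
    finrank K (homogeneousSubmodule (Fin (n + 1)) K 1) = n + 1 := by
  rw [homogeneousSubmodule_one_eq_span_X, finrank_span_eq_card (linearIndependent_X _ _)]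
  simp

theorem linearForms_pow (J : Ideal (CoordRing K n)) (l : CoordRing K n) (k : ℕ) :
    linearForms J l ^ k =
      (homogeneousSubmodule (Fin (n + 1)) K k).map (toAffine J l).toLinearMap := by
  rw [linearForms, ← Submodule.map_pow, homogeneousSubmodule_one_pow]

theorem finrank_map_le_of_forall_imp {M M₁ M₂ : Type*} [AddCommGroup M] [Module K M]
    [AddCommGroup M₁] [Module K M₁] [AddCommGroup M₂] [Module K M₂] (f : M →ₗ[K] M₁)
    (g : M →ₗ[K] M₂) (U : Submodule K M) [Module.Finite K U]
    (h : ∀ x ∈ U, f x = 0 → g x = 0) : finrank K (U.map g) ≤ finrank K (U.map f) := by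
  have hf := finrank_map_add_finrank_inf_ker f U
  have hg := finrank_map_add_finrank_inf_ker g U
  have hle : U ⊓ LinearMap.ker f ≤ U ⊓ LinearMap.ker g := fun x hx => ⟨hx.1, h x hx.1 hx.2⟩
  have : Module.Finite K (U ⊓ LinearMap.ker g : Submodule K M) :=
    Submodule.finiteDimensional_of_le inf_le_left
  have := Submodule.finrank_mono hle
  omega

theorem finrank_map_eq_of_forall_iff {M M₁ M₂ : Type*} [AddCommGroup M] [Module K M]
    [AddCommGroup M₁] [Module K M₁] [AddCommGroup M₂] [Module K M₂] (f : M →ₗ[K] M₁)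
    (g : M →ₗ[K] M₂) (U : Submodule K M) [Module.Finite K U]
    (h : ∀ x ∈ U, f x = 0 ↔ g x = 0) : finrank K (U.map f) = finrank K (U.map g) :=
  le_antisymm (finrank_map_le_of_forall_imp g f U fun x hx => (h x hx).mpr)
    (finrank_map_le_of_forall_imp f g U fun x hx => (h x hx).mp)

namespace ClosedSubscheme

variable {Γ : ClosedSubscheme K n} {l : CoordRing K n}

/-- Vanishing at `l = 1` puts some `l ^ m * f` into the ideal. Modulo the ideal powers of `x_i` are
multiples of `l ^ m`, so saturation applies. -/
theorem mem_ideal_iff (D : InvertibleForm Γ.ideal l) {f : CoordRing K n} {k : ℕ}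
    (hf : f.IsHomogeneous k) : f ∈ Γ.ideal ↔ toAffine Γ.ideal l f = 0 := by
  rw [Ideal.Quotient.mkₐ_eq_mk, Ideal.Quotient.eq_zero_iff_mem]
  refine ⟨fun h => Ideal.mem_sup_left h, fun h => ?_⟩
  obtain ⟨m, hm⟩ := exists_pow_mul_mem_of_mem_affineIdeal Γ.homogeneous D.isHomogeneous hf h
  refine Γ.saturated f fun i => ⟨(D.N + 1) * m, ?_⟩
  rw [← Ideal.Quotient.eq_zero_iff_mem] at hm ⊢
  simp only [map_mul, map_pow, D.mk_X_pow] at hm ⊢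
  linear_combination Ideal.Quotient.mk Γ.ideal (D.inv i) ^ m * hm

theorem hilbertFunction_eq (D : InvertibleForm Γ.ideal l) (k : ℕ) :
    hilbertFunction Γ.ideal k =
      finrank K (linearForms Γ.ideal l ^ k : Submodule K (AffineRing Γ.ideal l)) := by
  rw [linearForms_pow, hilbertFunction]
  refine finrank_map_eq_of_forall_iff _ _ _ fun f hf => ?_
  have h := mem_ideal_iff D hf
  rw [AlgHom.toLinearMap_apply, AlgHom.toLinearMap_apply, ← h, Ideal.Quotient.mkₐ_eq_mk,
    Ideal.Quotient.eq_zero_iff_mem]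

theorem finite_affineRing (D : InvertibleForm Γ.ideal l) {d : ℕ} (hd : Γ.degree = d) :
    Module.Finite K (AffineRing Γ.ideal l) := by
  rw [degree, D.length_eq] at hd
  have h1 : IsFiniteLength K (AffineRing Γ.ideal l) :=
    Module.length_ne_top_iff.mp (by rw [hd]; exact ENat.natCast_ne_top d)
  have := (isFiniteLength_iff_isNoetherian_isArtinian.mp h1).1
  infer_instance

theorem finrank_affineRing (D : InvertibleForm Γ.ideal l) {d : ℕ} (hd : Γ.degree = d) :
    finrank K (AffineRing Γ.ideal l) = d := by
  have := finite_affineRing D hd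
  rw [degree, D.length_eq, Module.length_eq_finrank] at hd
  exact_mod_cast hd

theorem h1_add_eq (hn : 2 ≤ n) (D : InvertibleForm Γ.ideal l) {d : ℕ} (hd : Γ.degree = d)
    (q : ℕ) :
    h1 Γ.ideal q + (finrank K (linearForms Γ.ideal l ^ q :
      Submodule K (AffineRing Γ.ideal l)) : ℕ) = d := by
  have := finite_affineRing D hd
  set V := linearForms Γ.ideal l
  let ψ : CoordRing K n →ₗ[K] (AffineRing Γ.ideal l ⧸ V ^ q) :=
    (V ^ q).mkQ ∘ₗ (toAffine Γ.ideal l).toLinearMap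
  have hψ : Function.Surjective ψ :=
    (Submodule.mkQ_surjective _).comp (Ideal.Quotient.mkₐ_surjective K _)
  have hker : LinearMap.ker ψ = (affineIdeal Γ.ideal l).restrictScalars K ⊔
      homogeneousSubmodule (Fin (n + 1)) K q := by
    rw [LinearMap.ker_comp, Submodule.ker_mkQ, linearForms_pow, Submodule.comap_map_eq, sup_comm]
    congr 1
    ext f
    exact Ideal.Quotient.eq_zero_iff_mem
  have h := (ψ.quotKerEquivOfSurjective hψ).length_eq
  rw [hker, ← D.h1_eq hn q, Module.length_eq_finrank] at h
  rw [h, ← finrank_affineRing D hd, ← Submodule.finrank_quotient_add_finrank (V ^ q)]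
  push_cast
  rfl

/-- The data inverting `l` on `Γ` also invert it on the linear section, so the same affine piece
computes both lengths. -/
theorem length_sup_span (D : InvertibleForm Γ.ideal l) {L : Submodule K (CoordRing K n)}
    (hL : L ≤ homogeneousSubmodule (Fin (n + 1)) K 1) :
    length (Γ.ideal ⊔ Ideal.span (L : Set (CoordRing K n))) =
      Module.length K (AffineRing Γ.ideal l ⧸
        Ideal.span ((L.map (toAffine Γ.ideal l).toLinearMap :
          Submodule K (AffineRing Γ.ideal l)) : Set (AffineRing Γ.ideal l))) := by
  have hhom : ∀ f ∈ Γ.ideal ⊔ Ideal.span (L : Set (CoordRing K n)), ∀ m : ℕ,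
      homogeneousComponent m f ∈ Γ.ideal ⊔ Ideal.span (L : Set (CoordRing K n)) := by
    intro f hf m
    obtain ⟨a, ha, b, hb, rfl⟩ := Submodule.mem_sup.mp hf
    rw [map_add]
    refine Submodule.add_mem_sup (Γ.homogeneous a ha m) ?_
    let _ := MvPolynomial.gradedAlgebra (σ := Fin (n + 1)) (R := K)
    exact homogeneousComponent_mem_of_mem
      (Ideal.homogeneous_span _ _ fun x hx => ⟨1, hL hx⟩) hb m
  let D' : InvertibleForm (Γ.ideal ⊔ Ideal.span (L : Set (CoordRing K n))) l :=
    ⟨hhom, D.isHomogeneous, D.N, D.inv, D.isHomogeneous_inv,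
      fun i => Ideal.mem_sup_left (D.sub_mem i)⟩
  rw [D'.length_eq]
  have e₁ : Ideal.span ((L.map (toAffine Γ.ideal l).toLinearMap :
      Submodule K (AffineRing Γ.ideal l)) : Set (AffineRing Γ.ideal l)) =
      (Ideal.span (L : Set (CoordRing K n))).map
        (Ideal.Quotient.mkₐ K (affineIdeal Γ.ideal l)) := by
    rw [Ideal.map_span]
    rfl
  have e₂ : affineIdeal (Γ.ideal ⊔ Ideal.span (L : Set (CoordRing K n))) l =
      affineIdeal Γ.ideal l ⊔ Ideal.span (L : Set (CoordRing K n)) := sup_right_comm _ _ _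
  rw [e₁, e₂]
  exact (DoubleQuot.quotQuotEquivQuotSupₐ K (affineIdeal Γ.ideal l)
    (Ideal.span (L : Set (CoordRing K n)))).toLinearEquiv.length_eq.symm

/-- A violation with `dim L = c` would be a secant plane of dimension `n - c < n`, against
minimality. -/
theorem IsInLinearlyGeneralPosition.finrank_quotient_add_finrank_le (hΓ : Γ.IsInLinearlyGeneralPosition)
    (D : InvertibleForm Γ.ideal l) [Module.Finite K (AffineRing Γ.ideal l)]
    {L : Submodule K (CoordRing K n)} (hL : L ≤ homogeneousSubmodule (Fin (n + 1)) K 1)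
    (h₁ : 1 ≤ finrank K L) (h₂ : finrank K L ≤ n) :
    finrank K (AffineRing Γ.ideal l ⧸
      Ideal.span ((L.map (toAffine Γ.ideal l).toLinearMap :
        Submodule K (AffineRing Γ.ideal l)) : Set (AffineRing Γ.ideal l))) +
      finrank K L ≤ n + 1 := by
  by_contra h
  have h3 := hΓ.2 (show n - finrank K L ∈ {t : ℕ | Γ.HasSecantPlane t} from
    ⟨L, hL, by omega, by
      rw [length_sup_span D hL, Module.length_eq_finrank]
      exact_mod_cast (by omega)⟩)
  omega

/-- A linear form dying in the affine ring would cut a section of length at least `n + 1` by a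
hyperplane; so linear forms embed and dimensions can be read upstairs. The case `W = V`, not covered
by secant planes, is trivial as `1 ∈ V`. -/
theorem IsInLinearlyGeneralPosition.isLinearlyGeneral (hΓ : Γ.IsInLinearlyGeneralPosition)
    (D : InvertibleForm Γ.ideal l) [Module.Finite K (AffineRing Γ.ideal l)] (hn : 1 ≤ n)
    (hd : n + 1 ≤ finrank K (AffineRing Γ.ideal l)) :
    IsLinearlyGeneral n (linearForms Γ.ideal l) := by
  set π := (toAffine Γ.ideal l).toLinearMap with hπ
  have hinj : homogeneousSubmodule (Fin (n + 1)) K 1 ⊓ LinearMap.ker π = ⊥ := by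
    rw [Submodule.eq_bot_iff]
    rintro f ⟨hf, hfπ⟩
    by_contra hf0
    have h1 : (K ∙ f).map π = ⊥ := by
      rw [Submodule.map_span, Set.image_singleton, LinearMap.mem_ker.mp hfπ]
      simp
    have h2 := hΓ.finrank_quotient_add_finrank_le D (L := K ∙ f) (by simpa using hf)
      (finrank_span_singleton hf0).ge ((finrank_span_singleton hf0).le.trans hn)
    have h3 := finrank_quotient_add_finrank_restrictScalars (K := K)
      (Ideal.span (((⊥ : Submodule K (AffineRing Γ.ideal l))) : Set (AffineRing Γ.ideal l)))
    rw [h1, finrank_span_singleton hf0] at h2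
    have h4 : Ideal.span (((⊥ : Submodule K (AffineRing Γ.ideal l))) : Set (AffineRing Γ.ideal l))
        = ⊥ := by simp
    rw [h4] at h2 h3
    rw [Submodule.restrictScalars_bot, finrank_bot] at h3
    omega
  have hdim : ∀ L ≤ homogeneousSubmodule (Fin (n + 1)) K 1, finrank K (L.map π) = finrank K L := by
    intro L hL
    have : Module.Finite K L := Submodule.finiteDimensional_of_le hL
    have h1 := finrank_map_add_finrank_inf_ker π L
    rwa [eq_bot_iff.mpr ((inf_le_inf_right _ hL).trans hinj.le), finrank_bot, add_zero] at h1
  have h1V : (1 : AffineRing Γ.ideal l) ∈ linearForms Γ.ideal l :=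
    ⟨l, D.isHomogeneous, mk_affineIdeal_self _ _⟩
  refine ⟨h1V, ?_, fun W hW hW0 => ?_⟩
  · rw [hdim _ le_rfl, finrank_homogeneousSubmodule_one]
  · obtain ⟨L, hL, rfl⟩ : ∃ L ≤ homogeneousSubmodule (Fin (n + 1)) K 1, L.map π = W := by
      refine ⟨homogeneousSubmodule (Fin (n + 1)) K 1 ⊓ W.comap π, inf_le_left, ?_⟩
      apply le_antisymm
      · rintro _ ⟨f, hf, rfl⟩
        exact hf.2
      · intro w hw
        obtain ⟨f, hf, rfl⟩ := hW hw
        exact ⟨f, ⟨hf, hw⟩, rfl⟩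
    have : Module.Finite K L := Submodule.finiteDimensional_of_le hL
    have h1 : 1 ≤ finrank K (L.map π) := by
      rwa [Nat.one_le_iff_ne_zero, Ne, Submodule.finrank_eq_zero]
    have h2 := Submodule.finrank_mono hL
    rw [finrank_homogeneousSubmodule_one] at h2
    by_cases h3 : finrank K L ≤ n
    · rw [hdim L hL] at h1 ⊢
      exact hΓ.finrank_quotient_add_finrank_le D hL h1 h3
    · have h4 : L = homogeneousSubmodule (Fin (n + 1)) K 1 :=
        Submodule.eq_of_le_of_finrank_le hL (by rw [finrank_homogeneousSubmodule_one]; omega)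
      have h5 : Ideal.span ((L.map π : Submodule K (AffineRing Γ.ideal l)) :
          Set (AffineRing Γ.ideal l)) = ⊤ := by
        rw [Ideal.eq_top_iff_one]
        exact Ideal.subset_span (h4 ▸ h1V)
      have h6 := finrank_quotient_add_finrank_restrictScalars (K := K)
        (Ideal.span ((L.map π : Submodule K (AffineRing Γ.ideal l)) :
          Set (AffineRing Γ.ideal l)))
      rw [h5, Submodule.restrictScalars_top, finrank_top] at h6
      rw [hdim L hL, h5]
      omega

end ClosedSubscheme

end AffineModel

/-! ### Rational normal curves and their determinantal equations. -/

section RationalNormalCurve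

variable {K : Type*} [Field K] {n : ℕ}

/-- The image of `ℙ¹` under nonzero binary forms of positive degree `m`. -/
def imageOfForms {m : ℕ} (hm : 1 ≤ m) (F : Fin (n + 1) → MvPolynomial (Fin 2) K)
    (hF : ∀ i, (F i).IsHomogeneous m) (hF0 : ∀ i, F i ≠ 0) : ClosedSubscheme K n where
  ideal := RingHom.ker (aeval F : CoordRing K n →ₐ[K] _)
  homogeneous := by
    intro f hf k
    rw [RingHom.mem_ker] at hf ⊢
    by_cases hk : k ≤ f.totalDegree
    · have h1 := congrArg (homogeneousComponent (m * k)) hf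
      rw [← sum_homogeneousComponent f, map_sum, map_sum, map_zero] at h1
      rw [Finset.sum_eq_single k] at h1
      · rwa [homogeneousComponent_eq_self
          ((homogeneousComponent_isHomogeneous k f).aeval F hF)] at h1
      · intro i _ hik
        rw [homogeneousComponent_of_mem ((homogeneousComponent_isHomogeneous i f).aeval F hF),
          if_neg]
        intro h
        exact hik (Nat.eq_of_mul_eq_mul_left (by omega) h).symm
      · intro h
        exact absurd (Finset.mem_range.mpr (by omega)) h
    · rw [homogeneousComponent_eq_zero _ _ (by omega), map_zero]
  saturated := by
    intro f hf
    obtain ⟨m, hm⟩ := hf 0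
    rw [RingHom.mem_ker, map_mul, map_pow, aeval_X] at hm
    exact (mul_eq_zero.mp hm).resolve_left (pow_ne_zero _ (hF0 0))

/-- The monomials of degree `n` in two variables. -/
abbrev binaryMonomial (K : Type*) [Field K] (n : ℕ) (i : Fin (n + 1)) : MvPolynomial (Fin 2) K :=
  X 0 ^ (n - i : ℕ) * X 1 ^ (i : ℕ)

theorem isHomogeneous_binaryMonomial (i : Fin (n + 1)) :
    (binaryMonomial K n i).IsHomogeneous n := by
  have := ((isHomogeneous_X K (0 : Fin 2)).pow (n - i : ℕ)).mul
    ((isHomogeneous_X K (1 : Fin 2)).pow (i : ℕ))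
  rwa [show 1 * (n - i : ℕ) + 1 * (i : ℕ) = n by omega] at this

theorem linearIndependent_binaryMonomial : LinearIndependent K (binaryMonomial K n) := by
  have h := (basisMonomials (Fin 2) K).linearIndependent.comp
    (fun i : Fin (n + 1) => Finsupp.single 0 (n - i : ℕ) + Finsupp.single 1 (i : ℕ)) (by
      intro i j hij
      have := DFunLike.congr_fun hij 1
      simpa [Fin.val_inj] using this)
  have e : binaryMonomial K n = basisMonomials (Fin 2) K ∘ fun i : Fin (n + 1) =>
      Finsupp.single 0 (n - i : ℕ) + Finsupp.single 1 (i : ℕ) := by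
    funext i
    simp [binaryMonomial, X_pow_eq_monomial, monomial_mul]
  rw [e]
  exact h

theorem finrank_homogeneousSubmodule_two_le (m : ℕ) :
    finrank K (homogeneousSubmodule (Fin 2) K m) ≤ m + 1 := by
  have h : homogeneousSubmodule (Fin 2) K m ≤
      Submodule.span K (Set.range (binaryMonomial K m)) := by
    intro f hf
    rw [f.as_sum]
    refine Submodule.sum_mem _ fun d hd => ?_
    have hdm : d.degree = m := by
      by_contra h
      exact mem_support_iff.mp hd (IsHomogeneous.coeff_eq_zero hf h)
    rw [Finsupp.degree_eq_sum, Fin.sum_univ_two] at hdm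
    have : monomial d (coeff d f) = coeff d f • binaryMonomial K m ⟨d 1, by omega⟩ := by
      rw [monomial_eq, Finsupp.prod_fintype _ _ (fun i => pow_zero _), Fin.prod_univ_two,
        smul_eq_C_mul, binaryMonomial, show m - d 1 = d 0 by omega]
    rw [this]
    exact Submodule.smul_mem _ _ (Submodule.subset_span ⟨_, rfl⟩)
  have := FiniteDimensional.span_of_finite K (Set.finite_range (binaryMonomial K m))
  refine (Submodule.finrank_mono h).trans ((finrank_range_le_card _).trans ?_)
  simp

/-- The Hilbert function of a subscheme of a rational normal curve. -/
theorem ClosedSubscheme.IsRationalNormalCurve.hilbertFunction_le {C : ClosedSubscheme K n}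
    (hC : C.IsRationalNormalCurve) {J : Ideal (CoordRing K n)} (hJ : C.ideal ≤ J) (k : ℕ) :
    hilbertFunction J k ≤ n * k + 1 := by
  obtain ⟨F, hF, -, hCF⟩ := hC
  have h1 := finrank_map_le_of_forall_imp
    (aeval F : CoordRing K n →ₐ[K] MvPolynomial (Fin 2) K).toLinearMap
    (Ideal.Quotient.mkₐ K J).toLinearMap (homogeneousSubmodule (Fin (n + 1)) K k) (by
      intro f _ hf
      have hf' : f ∈ C.ideal := hCF ▸ hf
      exact Ideal.Quotient.eq_zero_iff_mem.mpr (hJ hf'))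
  have h5 : (homogeneousSubmodule (Fin (n + 1)) K k).map
      (aeval F : CoordRing K n →ₐ[K] MvPolynomial (Fin 2) K).toLinearMap ≤
      homogeneousSubmodule (Fin 2) K (n * k) := by
    rintro _ ⟨f, hf, rfl⟩
    exact IsHomogeneous.aeval hf F hF
  have : Module.Finite K (homogeneousSubmodule (Fin 2) K (n * k)) :=
    Module.Finite.iff_fg.mpr (homogeneousSubmodule_fg _ _ _)
  exact h1.trans ((Submodule.finrank_mono h5).trans (finrank_homogeneousSubmodule_two_le (n * k)))

section Minors

variable {A : Type*} [CommRing A] {u : ℕ → A}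

/-- In a maximal ideal containing `u 0` and `u n`, the relations `u (i + 1) ^ 2 = u i * u (i + 2)`
propagate membership to every `u i`. -/
theorem span_pair_eq_top_of_minors {n : ℕ}
    (hu : ∀ i < n, ∀ j < n, u i * u (j + 1) = u (i + 1) * u j)
    (h1 : Ideal.span (u '' Set.Iic n) = ⊤) : Ideal.span {u 0, u n} = ⊤ := by
  by_contra h
  obtain ⟨m, hm, hle⟩ := Ideal.exists_le_maximal _ h
  have h0 : u 0 ∈ m := hle (Ideal.subset_span (by simp))
  have hn : u n ∈ m := hle (Ideal.subset_span (by simp))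
  have hi : ∀ i ≤ n, u i ∈ m := by
    intro i
    induction i with
    | zero => exact fun _ => h0
    | succ i ih =>
      intro hi
      rcases hi.eq_or_lt with h | h
      · exact h ▸ hn
      · have := hu i (by omega) (i + 1) h
        refine (hm.isPrime.mem_or_mem (this ▸ m.mul_mem_right _ (ih (by omega)))).elim id id
  refine hm.ne_top (top_le_iff.mp (h1 ▸ Ideal.span_le.mpr ?_))
  rintro _ ⟨i, hi', rfl⟩
  exact hi i hi'

/-- Where `u 0` is invertible, the minors involving the first column say that the `u i` form a
geometric progression. -/
theorem map_eq_mul_pow_of_minors {B : Type*} [CommRing B] {n : ℕ} (hn : 1 ≤ n)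
    (hu : ∀ i < n, ∀ j < n, u i * u (j + 1) = u (i + 1) * u j) (ρ : A →+* B)
    {c : B} (hc : ρ (u 0) * c = 1) (i : ℕ) (hi : i ≤ n) :
    ρ (u i) = ρ (u 0) * (ρ (u 1) * c) ^ i := by
  induction i with
  | zero => simp
  | succ i ih =>
    have h := congrArg ρ (hu 0 (by omega) i (by omega))
    rw [map_mul, map_mul, zero_add] at h
    rw [pow_succ, ← mul_assoc, ← ih (by omega)]
    linear_combination c * h - ρ (u (i + 1)) * hc

theorem map_eq_mul_pow_of_minors_last {B : Type*} [CommRing B] {n : ℕ} (hn : 1 ≤ n)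
    (hu : ∀ i < n, ∀ j < n, u i * u (j + 1) = u (i + 1) * u j) (ρ : A →+* B)
    {c : B} (hc : ρ (u n) * c = 1) (i : ℕ) (hi : i ≤ n) :
    ρ (u i) = ρ (u n) * (ρ (u (n - 1)) * c) ^ (n - i) := by
  have h := map_eq_mul_pow_of_minors (u := fun i => u (n - i)) hn (fun i hi j hj => by
    have := hu (n - (i + 1)) (by omega) (n - (j + 1)) (by omega)
    rw [show n - (i + 1) + 1 = n - i by omega, show n - (j + 1) + 1 = n - j by omega] at this
    exact this.symm) ρ hc (n - i) (by omega)
  simpa [Nat.sub_sub_self hi] using h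

end Minors

variable {A : Type*} [CommRing A] [Algebra K A]

/-- A form that vanishes on the rational normal curve vanishes wherever the curve is
parametrized. -/
theorem map_aeval_eq_zero_of_parametrization {B : Type*} [CommRing B] [Algebra K B] (ρ : A →ₐ[K] B)
    {V : Submodule K A} (b : Basis (Fin (n + 1)) K V) {x : Fin (n + 1) → V} {c σ τ : B}
    (hb : ∀ i, ρ (b i) = c * (σ ^ (n - i : ℕ) * τ ^ (i : ℕ))) {f : CoordRing K n} {k : ℕ}
    (hf : f.IsHomogeneous k)
    (hfF : aeval (fun j => b.constr K (binaryMonomial K n) (x j)) f = 0) :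
    ρ (aeval (fun j => (x j : A)) f) = 0 := by
  let ev : MvPolynomial (Fin 2) K →ₐ[K] B := aeval ![σ, τ]
  have hlin : ρ.toLinearMap ∘ₗ V.subtype =
      LinearMap.mulLeft K c ∘ₗ ev.toLinearMap ∘ₗ b.constr K (binaryMonomial K n) := by
    refine b.ext fun i => ?_
    simp [hb, ev]
  have hx : ∀ j, ρ (x j) = c * ev (b.constr K (binaryMonomial K n) (x j)) := fun j =>
    DFunLike.congr_fun hlin (x j)
  rw [← AlgHom.comp_apply, comp_aeval]
  simp only [hx]
  rw [aeval_mul_of_isHomogeneous hf, ← comp_aeval, AlgHom.comp_apply, hfF, map_zero, mul_zero]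

/-- The loci where `u 0` and `u n` are invertible cover the scheme. The first is parametrized by `(1
: u 1 / u 0)`, the second by `(u (n - 1) / u n : 1)`, so powers of both `u 0` and `u n` kill the
value of `f`. -/
theorem aeval_eq_zero_of_minors (hn : 1 ≤ n) {V : Submodule K A} (h1 : 1 ∈ V)
    (b : Basis (Fin (n + 1)) K V) {u : ℕ → A} (hbu : ∀ i, (b i : A) = u i)
    (hu : ∀ i < n, ∀ j < n, u i * u (j + 1) = u (i + 1) * u j) {x : Fin (n + 1) → V}
    {f : CoordRing K n} {k : ℕ} (hf : f.IsHomogeneous k)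
    (hfF : aeval (fun j => b.constr K (binaryMonomial K n) (x j)) f = 0) :
    aeval (fun j => (x j : A)) f = 0 := by
  set y := aeval (fun j => (x j : A)) f with hy
  have htop : Ideal.span (u '' Set.Iic n) = ⊤ := by
    rw [Ideal.eq_top_iff_one]
    have := congrArg Subtype.val (b.sum_repr ⟨1, h1⟩)
    rw [← show _ = (1 : A) from this, Submodule.coe_sum]
    refine Ideal.sum_mem _ fun i _ => ?_
    rw [Submodule.coe_smul, hbu]
    exact Submodule.smul_of_tower_mem _ _ (Ideal.subset_span ⟨i, by
      have := i.2
      simp only [Set.mem_Iic]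
      omega, rfl⟩)
  have hann : ∀ v : A, (∃ σ τ : Localization.Away v, ∀ i : Fin (n + 1),
      algebraMap A (Localization.Away v) (u i) =
        algebraMap A (Localization.Away v) v * (σ ^ (n - i : ℕ) * τ ^ (i : ℕ))) →
      ∃ m : ℕ, v ^ m * y = 0 := by
    rintro v ⟨σ, τ, h⟩
    have h0 := map_aeval_eq_zero_of_parametrization
      (IsScalarTower.toAlgHom K A (Localization.Away v)) b (x := x) (fun i => by
        rw [hbu]
        exact h i) hf hfF
    change algebraMap A (Localization.Away v) y = 0 at h0
    rw [IsLocalization.map_eq_zero_iff (Submonoid.powers v)] at h0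
    obtain ⟨⟨_, m, rfl⟩, hm⟩ := h0
    exact ⟨m, hm⟩
  obtain ⟨m₀, h₀⟩ := hann (u 0) ⟨1, algebraMap A _ (u 1) *
    IsLocalization.Away.invSelf (u 0), fun i => by
      rw [one_pow, one_mul]
      exact map_eq_mul_pow_of_minors hn hu (algebraMap A _)
        (IsLocalization.Away.mul_invSelf (u 0)) i (by omega)⟩
  obtain ⟨m₁, h₁⟩ := hann (u n) ⟨algebraMap A _ (u (n - 1)) *
    IsLocalization.Away.invSelf (u n), 1, fun i => by
      rw [one_pow, mul_one]
      exact map_eq_mul_pow_of_minors_last hn hu (algebraMap A _)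
        (IsLocalization.Away.mul_invSelf (u n)) i (by omega)⟩
  have hcop : IsCoprime (u 0) (u n) := by
    rw [← Ideal.isCoprime_span_singleton_iff, Ideal.isCoprime_iff_sup_eq, ← Ideal.span_insert]
    exact span_pair_eq_top_of_minors hu htop
  obtain ⟨p, p', hp⟩ := hcop.pow (m := m₀) (n := m₁)
  linear_combination (-y) * hp + p * h₀ + p' * h₁

end RationalNormalCurve

namespace ClosedSubscheme

variable {K : Type*} [Field K] {n : ℕ} {Γ : ClosedSubscheme K n} {l : CoordRing K n}

/-- The curve is given by writing each coordinate in the basis `u` and replacing `u i` by the `i`-th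
binary monomial. This map is injective on `V`, so the resulting binary forms are independent. -/
theorem liesOnRationalNormalCurve_of_minors (hn : 1 ≤ n) (D : InvertibleForm Γ.ideal l)
    (hV : IsLinearlyGeneral n (linearForms Γ.ideal l)) {u : ℕ → AffineRing Γ.ideal l}
    (huV : ∀ i ≤ n, u i ∈ linearForms Γ.ideal l)
    (hli : LinearIndependent K fun i : Fin (n + 1) => u i)
    (hu : ∀ i < n, ∀ j < n, u i * u (j + 1) = u (i + 1) * u j) :
    Γ.LiesOnRationalNormalCurve := by
  set V := linearForms Γ.ideal l with hVdef
  have hfin : Module.Finite K V := Module.finite_of_finrank_pos (by rw [hV.finrank_eq]; omega)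
  let b : Basis (Fin (n + 1)) K V := basisOfLinearIndependentOfCardEqFinrank
    (b := fun i : Fin (n + 1) => (⟨u i, huV i (by omega)⟩ : V))
    (LinearIndependent.of_comp V.subtype hli) (by rw [hV.finrank_eq, Fintype.card_fin])
  have hb : ∀ i, (b i : AffineRing Γ.ideal l) = u i := fun i => by simp [b]
  let x : Fin (n + 1) → V := fun j => ⟨toAffine Γ.ideal l (X j), X j, isHomogeneous_X K j, rfl⟩
  have hx : LinearIndependent K x := by
    refine LinearIndependent.of_comp V.subtype ?_
    have hspan : Submodule.span K (Set.range (V.subtype ∘ x)) = V := by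
      have e : V = Submodule.span K (Set.range ((toAffine Γ.ideal l).toLinearMap ∘ X)) := by
        rw [hVdef, linearForms, homogeneousSubmodule_one_eq_span_X, Submodule.map_span,
          ← Set.range_comp]
      exact e.symm
    rw [linearIndependent_iff_card_eq_finrank_span, Set.finrank, Fintype.card_fin, hspan,
      hV.finrank_eq]
  let F : Fin (n + 1) → MvPolynomial (Fin 2) K := fun j =>
    b.constr K (binaryMonomial K n) (x j)
  have hFh : ∀ j, (F j).IsHomogeneous n := by
    intro j
    change b.constr K (binaryMonomial K n) (x j) ∈ homogeneousSubmodule (Fin 2) K n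
    rw [Basis.constr_apply_fintype]
    exact Submodule.sum_mem _ fun i _ => Submodule.smul_mem _ _ (isHomogeneous_binaryMonomial i)
  have hFli : LinearIndependent K F := by
    refine hx.map' (b.constr K (binaryMonomial K n)) ?_
    rw [LinearMap.ker_eq_bot']
    intro v hv
    rw [Basis.constr_apply_fintype] at hv
    have := Fintype.linearIndependent_iff.mp (linearIndependent_binaryMonomial (K := K)) _ hv
    refine b.ext_elem fun i => ?_
    rw [b.repr.map_zero, Finsupp.zero_apply]
    exact this i
  refine ⟨imageOfForms hn F hFh fun j => hFli.ne_zero j, ⟨F, hFh, hFli, rfl⟩, ?_⟩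
  intro f hf
  have hcomp := (imageOfForms hn F hFh fun j => hFli.ne_zero j).homogeneous f hf
  rw [← sum_homogeneousComponent f]
  refine Ideal.sum_mem _ fun k _ => ?_
  have hk := homogeneousComponent_isHomogeneous k f
  rw [mem_ideal_iff D hk]
  have := aeval_eq_zero_of_minors hn hV.one_mem b hb hu (x := x) hk (hcomp k)
  rw [← this]
  exact DFunLike.congr_fun (aeval_unique (toAffine Γ.ideal l)) _

end ClosedSubscheme

/-! ### Reduced schemes and uniform position. -/

section Points

variable {K : Type*} [Field K] {n : ℕ}

/-- Evaluation of polynomials at a family of points of affine space. -/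
def evalPoints {ι : Type*} (w : ι → Fin (n + 1) → K) : CoordRing K n →ₐ[K] (ι → K) :=
  AlgHom.pi fun p => aeval (w p)

@[simp]
theorem evalPoints_apply {ι : Type*} (w : ι → Fin (n + 1) → K) (f : CoordRing K n) (p : ι) :
    evalPoints w f p = eval (w p) f :=
  DFunLike.congr_fun (coe_aeval_eq_eval (w p)) f

/-- A functional vanishing on the image is a linear relation between distinct evaluation characters,
excluded by Dedekind's independence of characters. -/
theorem evalPoints_surjective {ι : Type*} [Finite ι] {w : ι → Fin (n + 1) → K}
    (hw : Function.Injective w) : Function.Surjective (evalPoints w) := by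
  classical
  have := Fintype.ofFinite ι
  let χ : ι → (CoordRing K n →* K) := fun p => (eval (w p)).toMonoidHom
  have hχ : Function.Injective χ := by
    intro p p' h
    refine hw (funext fun j => ?_)
    simpa [χ] using DFunLike.congr_fun h (X j)
  have hli := (linearIndependent_monoidHom (CoordRing K n) K).comp χ hχ
  change Function.Surjective (evalPoints w).toLinearMap
  rw [← LinearMap.range_eq_top]
  by_contra h
  obtain ⟨ψ, hψ0, hψ⟩ := Submodule.exists_le_ker_of_lt_top _ (lt_top_iff_ne_top.mpr h)
  have hψe : ∀ v : ι → K, ψ v = ∑ p, ψ (Pi.single p 1) * v p := by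
    intro v
    conv_lhs => rw [pi_eq_sum_univ' v, map_sum]
    simp [mul_comm]
  have h0 := Fintype.linearIndependent_iff.mp hli (fun p => ψ (Pi.single p 1)) (by
    funext f
    have : ψ (evalPoints w f) = 0 := hψ ⟨f, rfl⟩
    rw [hψe] at this
    simpa [χ] using this)
  exact hψ0 (LinearMap.ext fun v => by simp [hψe v, h0])

theorem mem_pointsIdeal_iff {Y : Finset (ℙ K (Fin (n + 1) → K))} {f : CoordRing K n} {k : ℕ}
    (hf : f.IsHomogeneous k) : f ∈ pointsIdeal Y ↔ ∀ p ∈ Y, eval p.rep f = 0 := by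
  have hmem : f ∈ pointsIdeal Y ↔
      ∀ x ∈ ⋃ p ∈ Y, (p.submodule : Set (Fin (n + 1) → K)), eval x f = 0 := by
    simp only [← coe_aeval_eq_eval]
    exact Iff.rfl
  rw [hmem]
  constructor
  · intro h p hp
    refine h _ (Set.mem_iUnion₂.mpr ⟨p, hp, ?_⟩)
    rw [SetLike.mem_coe, Projectivization.submodule_eq]
    exact Submodule.mem_span_singleton_self _
  · intro h x hx
    obtain ⟨p, hp, hx⟩ := Set.mem_iUnion₂.mp hx
    rw [SetLike.mem_coe, Projectivization.submodule_eq] at hx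
    obtain ⟨c, rfl⟩ := Submodule.mem_span_singleton.mp hx
    rw [eval_smul_of_isHomogeneous hf, h p hp, mul_zero]

theorem pointsIdeal_anti {Y S : Finset (ℙ K (Fin (n + 1) → K))} (h : Y ⊆ S) :
    pointsIdeal S ≤ pointsIdeal Y :=
  fun _ hf x hx => hf x (Set.biUnion_subset_biUnion_left h hx)

/-- The Hilbert function of a set of points is the rank of the evaluation of forms. -/
theorem hilbertFunction_pointsIdeal (Y : Finset (ℙ K (Fin (n + 1) → K))) {c : Y → K}
    (hc : ∀ p, c p ≠ 0) (k : ℕ) :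
    hilbertFunction (pointsIdeal Y) k = finrank K ((homogeneousSubmodule (Fin (n + 1)) K k).map
      (evalPoints fun p : Y => c p • p.1.rep).toLinearMap) := by
  refine finrank_map_eq_of_forall_iff _ _ _ fun f hf => ?_
  have h1 : (Ideal.Quotient.mkₐ K (pointsIdeal Y)).toLinearMap f = 0 ↔ f ∈ pointsIdeal Y :=
    Ideal.Quotient.eq_zero_iff_mem
  rw [h1, mem_pointsIdeal_iff hf, AlgHom.toLinearMap_apply, funext_iff]
  simp only [evalPoints_apply, eval_smul_of_isHomogeneous hf, Pi.zero_apply, mul_eq_zero,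
    pow_eq_zero_iff', hc, false_and, false_or, Subtype.forall]

theorem hilbertFunction_pointsIdeal_le_card (Y : Finset (ℙ K (Fin (n + 1) → K))) (k : ℕ) :
    hilbertFunction (pointsIdeal Y) k ≤ Y.card := by
  rw [hilbertFunction_pointsIdeal Y (c := fun _ => 1) (fun _ => one_ne_zero)]
  refine (Submodule.finrank_le _).trans ?_
  simp

theorem eval_rep_ne_zero_of_invertibleForm {S : Finset (ℙ K (Fin (n + 1) → K))} {l : CoordRing K n}
    (D : InvertibleForm (pointsIdeal S) l) {p : ℙ K (Fin (n + 1) → K)} (hp : p ∈ S) :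
    eval p.rep l ≠ 0 := by
  intro h
  refine p.rep_nonzero (funext fun i => ?_)
  have hhom : (X i ^ (D.N + 1) - l * D.inv i).IsHomogeneous (D.N + 1) := by
    refine IsHomogeneous.sub (by simpa using (isHomogeneous_X K i).pow (D.N + 1)) ?_
    exact add_comm 1 D.N ▸ D.isHomogeneous.mul (D.isHomogeneous_inv i)
  have := (mem_pointsIdeal_iff hhom).mp (D.sub_mem i) p hp
  simpa [h] using this

/-- This is Castelnuovo's bound relative to the ideal of `Y` in the affine ring; the representatives
are scaled to satisfy `l = 1`. -/
theorem min_card_le_hilbertFunction [IsAlgClosed K] {S : Finset (ℙ K (Fin (n + 1) → K))}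
    {l : CoordRing K n} (D : InvertibleForm (pointsIdeal S) l)
    [Module.Finite K (AffineRing (pointsIdeal S) l)]
    (hV : IsLinearlyGeneral n (linearForms (pointsIdeal S) l))
    {Y : Finset (ℙ K (Fin (n + 1) → K))} (hY : Y ⊆ S) (k : ℕ) :
    min Y.card (n * k + 1) ≤ hilbertFunction (pointsIdeal Y) k := by
  have hl : ∀ p : Y, eval p.1.rep l ≠ 0 := fun p =>
    eval_rep_ne_zero_of_invertibleForm D (hY p.2)
  let w : Y → Fin (n + 1) → K := fun p => (eval p.1.rep l)⁻¹ • p.1.rep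
  have hw : Function.Injective w := by
    intro p p' h
    have hsub : ∀ p : Y, p.1.submodule = K ∙ w p := by
      intro p
      rw [Projectivization.submodule_eq]
      exact (Submodule.span_singleton_smul_eq (IsUnit.mk0 _ (inv_ne_zero (hl p))) _).symm
    refine Subtype.ext (Projectivization.submodule_injective ?_)
    rw [hsub, hsub, h]
  have hle : affineIdeal (pointsIdeal S) l ≤ RingHom.ker (evalPoints w) := by
    refine sup_le (fun f hf => ?_) (Ideal.span_le.mpr (Set.singleton_subset_iff.mpr ?_))
    · rw [RingHom.mem_ker]
      funext p
      rw [evalPoints_apply, ← coe_aeval_eq_eval]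
      refine hf _ (Set.mem_iUnion₂.mpr ⟨p, hY p.2, ?_⟩)
      rw [SetLike.mem_coe, Projectivization.submodule_eq]
      exact Submodule.smul_mem _ _ (Submodule.mem_span_singleton_self _)
    · change evalPoints w (l - 1) = 0
      funext p
      rw [evalPoints_apply, map_sub, eval_smul_of_isHomogeneous D.isHomogeneous]
      simp [hl p]
  let ψ : AffineRing (pointsIdeal S) l →ₐ[K] (Y → K) :=
    Ideal.Quotient.liftₐ _ (evalPoints w) fun f hf => hle hf
  have hψ : ∀ f, ψ (toAffine (pointsIdeal S) l f) = evalPoints w f := fun f => rfl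
  have hψs : Function.Surjective ψ := by
    intro v
    obtain ⟨f, rfl⟩ := evalPoints_surjective hw v
    exact ⟨_, hψ f⟩
  have h1 := LinearMap.finrank_range_add_finrank_ker ψ.toLinearMap
  rw [LinearMap.range_eq_top.mpr hψs, finrank_top, finrank_fintype_fun_eq_card,
    Fintype.card_coe] at h1
  have h2 := finrank_map_add_finrank_inf_ker ψ.toLinearMap
    (linearForms (pointsIdeal S) l ^ k)
  have h3 := hV.min_le_finrank_pow_sup k (RingHom.ker ψ)
  have hker : (RingHom.ker ψ).restrictScalars K = LinearMap.ker ψ.toLinearMap := rfl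
  rw [hker] at h3
  have h4 := Submodule.finrank_sup_add_finrank_inf_eq (linearForms (pointsIdeal S) l ^ k)
    (LinearMap.ker ψ.toLinearMap)
  have h5 : hilbertFunction (pointsIdeal Y) k =
      finrank K ((linearForms (pointsIdeal S) l ^ k).map ψ.toLinearMap) := by
    rw [hilbertFunction_pointsIdeal Y (fun p => inv_ne_zero (hl p)), linearForms_pow,
      ← Submodule.map_comp]
    rfl
  omega

namespace IsInUniformPosition

variable {S : Finset (ℙ K (Fin (n + 1) → K))}

/-- Uniform position gives `h_Y(k) = |Y|`, so every function on `Y`, in particular the indicator of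
`p`, comes from a form. -/
theorem exists_form (hS : IsInUniformPosition S) {Y : Finset (ℙ K (Fin (n + 1) → K))} (hY : Y ⊆ S)
    {k : ℕ} (hk : Y.card ≤ hilbertFunction (pointsIdeal S) k) {p : ℙ K (Fin (n + 1) → K)}
    (hp : p ∈ Y) :
    ∃ f : CoordRing K n, f.IsHomogeneous k ∧ eval p.rep f = 1 ∧
      ∀ p' ∈ Y, p' ≠ p → eval p'.rep f = 0 := by
  classical
  have h1 := hS.2 Y hY k
  rw [min_eq_left hk, hilbertFunction_pointsIdeal Y (c := fun _ => 1) (fun _ => one_ne_zero)] at h1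
  have h2 : (homogeneousSubmodule (Fin (n + 1)) K k).map
      (evalPoints fun p : Y => (1 : K) • p.1.rep).toLinearMap = ⊤ :=
    Submodule.eq_top_of_finrank_eq (by rw [h1]; simp)
  obtain ⟨f, hf, e⟩ : Pi.single (M := fun _ : Y => K) ⟨p, hp⟩ 1 ∈
      (homogeneousSubmodule (Fin (n + 1)) K k).map
        (evalPoints fun p : Y => (1 : K) • p.1.rep).toLinearMap := h2 ▸ Submodule.mem_top
  have he : ∀ p' : Y, eval p'.1.rep f = Pi.single (M := fun _ : Y => K) ⟨p, hp⟩ 1 p' := by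
    intro p'
    rw [← e, AlgHom.toLinearMap_apply, evalPoints_apply, one_smul]
  refine ⟨f, hf, ?_, fun p' hp' hne => ?_⟩
  · rw [he ⟨p, hp⟩, Pi.single_eq_same]
  · rw [he ⟨p', hp'⟩, Pi.single_eq_of_ne]
    exact fun h => hne (congrArg Subtype.val h)

/-- Superadditivity of the Hilbert function of points in uniform position. -/
theorem min_le_hilbertFunction_add (hS : IsInUniformPosition S) {a b : ℕ}
    (ha : 1 ≤ hilbertFunction (pointsIdeal S) a) (hb : 1 ≤ hilbertFunction (pointsIdeal S) b) :
    min S.card (hilbertFunction (pointsIdeal S) a + hilbertFunction (pointsIdeal S) b - 1) ≤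
      hilbertFunction (pointsIdeal S) (a + b) := by
  classical
  set ha' := hilbertFunction (pointsIdeal S) a
  set hb' := hilbertFunction (pointsIdeal S) b
  obtain ⟨Y, hYS, hYc⟩ := Finset.exists_subset_card_eq
    (show min S.card (ha' + hb' - 1) ≤ S.card from min_le_left _ _)
  have hform : ∀ p ∈ Y, ∃ f : CoordRing K n, f.IsHomogeneous (a + b) ∧ eval p.rep f = 1 ∧
      ∀ p' ∈ Y, p' ≠ p → eval p'.rep f = 0 := by
    intro p hp
    have hcard := Finset.card_erase_of_mem hp
    -- Split the at most `ha' + hb' - 2` other points into parts of size at most `ha' - 1` and `hb'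
    -- - 1`. A form of degree `a` kills the first, one of degree `b` the second, and their product
    -- isolates `p`.
    obtain ⟨Y₁, hY₁, hY₁c⟩ := Finset.exists_subset_card_eq
      (show min (Y.erase p).card (ha' - 1) ≤ (Y.erase p).card from min_le_left _ _)
    have hY₁Y : Y₁ ⊆ Y := hY₁.trans (Finset.erase_subset _ _)
    have hc₁ := Finset.card_insert_le p Y₁
    have hc₂ := Finset.card_insert_le p (Y.erase p \ Y₁)
    have hc₃ := Finset.card_sdiff_of_subset hY₁
    obtain ⟨f, hf, hfp, hf0⟩ := hS.exists_form (Y := insert p Y₁) (k := a) (p := p)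
      ((Finset.insert_subset hp hY₁Y).trans hYS) (by omega) (Finset.mem_insert_self _ _)
    obtain ⟨g, hg, hgp, hg0⟩ := hS.exists_form (Y := insert p (Y.erase p \ Y₁)) (k := b) (p := p)
      ((Finset.insert_subset hp (Finset.sdiff_subset.trans (Finset.erase_subset _ _))).trans hYS)
      (by omega) (Finset.mem_insert_self _ _)
    refine ⟨f * g, hf.mul hg, by rw [map_mul, hfp, hgp, one_mul], fun p' hp' hne => ?_⟩
    rw [map_mul]
    by_cases h : p' ∈ Y₁
    · rw [hf0 p' (Finset.mem_insert_of_mem h) hne, zero_mul]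
    · rw [hg0 p' (Finset.mem_insert_of_mem (Finset.mem_sdiff.mpr
        ⟨Finset.mem_erase.mpr ⟨hne, hp'⟩, h⟩)) hne, mul_zero]
  have htop : (homogeneousSubmodule (Fin (n + 1)) K (a + b)).map
      (evalPoints fun p : Y => (1 : K) • p.1.rep).toLinearMap = ⊤ := by
    rw [eq_top_iff, ← (Pi.basisFun K Y).span_eq, Submodule.span_le]
    rintro _ ⟨⟨p, hp⟩, rfl⟩
    obtain ⟨f, hf, hfp, hf0⟩ := hform p hp
    refine ⟨f, hf, funext fun p' => ?_⟩
    rw [AlgHom.toLinearMap_apply, evalPoints_apply, one_smul, Pi.basisFun_apply]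
    by_cases h : p' = ⟨p, hp⟩
    · subst h
      rw [hfp, Pi.single_eq_same]
    · rw [hf0 _ p'.2 (fun e => h (Subtype.ext e)), Pi.single_eq_of_ne h]
  have h1 := hilbertFunction_pointsIdeal Y (c := fun _ => (1 : K)) (fun _ => one_ne_zero) (a + b)
  rw [htop, finrank_top, finrank_fintype_fun_eq_card, Fintype.card_coe, hS.2 Y hYS, hYc] at h1
  rw [← h1]
  exact min_le_right _ _

/-- One condition in degree 3 beyond the minimum is gained again at each superadditive step of 3.
After `n` steps the excess is `n`, enough to reach `n * q + n + 1 ≥ d` in degree `q`. -/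
theorem hilbertFunction_three_eq (hS : IsInUniformPosition S) {d q r : ℕ} (hn : 1 ≤ n)
    (hdS : d ≤ S.card)
    (hmin : ∀ k, min d (n * k + 1) ≤ hilbertFunction (pointsIdeal S) k)
    (hdq : d = n * q + r + 2) (hr : r ≤ n - 1) (hq : 3 * n ≤ q) (hq3 : 3 ≤ q)
    (hlt : hilbertFunction (pointsIdeal S) q < d) :
    hilbertFunction (pointsIdeal S) 3 = n * 3 + 1 := by
  set h := hilbertFunction (pointsIdeal S) with hh
  have hnq : n * 3 ≤ n * q := Nat.mul_le_mul_left n hq3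
  have hpos : ∀ k, 1 ≤ h k := fun k => le_trans (by omega) (hmin k)
  have h3 := hmin 3
  by_contra hne
  have hmul : ∀ j, min d (j * (n * 3 + 1) + 1) ≤ h (3 * j) := by
    intro j
    induction j with
    | zero => exact le_trans (by omega) (hpos 0)
    | succ j ih =>
      have h1 := hS.min_le_hilbertFunction_add (hpos (3 * j)) (hpos 3)
      rw [← hh, show 3 * j + 3 = 3 * (j + 1) by ring] at h1
      rw [show (j + 1) * (n * 3 + 1) = j * (n * 3 + 1) + (n * 3 + 1) by ring]
      omega
  have h1 := hS.min_le_hilbertFunction_add (hpos (3 * n)) (hpos (q - 3 * n))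
  rw [← hh, Nat.add_sub_cancel' hq] at h1
  have h2 := hmul n
  have h4 := hmin (q - 3 * n)
  have h5 : n * (n * 3 + 1) + n * (q - 3 * n) = n * q + n := by
    obtain ⟨c, rfl⟩ := Nat.exists_eq_add_of_le hq
    rw [Nat.add_sub_cancel_left]
    ring
  omega

end IsInUniformPosition

end Points

/-! ### Consequences for the subscheme. -/

section Main

variable {K : Type*} [Field K] {n : ℕ} {Γ : ClosedSubscheme K n} {l : CoordRing K n}

theorem ClosedSubscheme.liesOnRationalNormalCurve_of_hilbertFunction_eq [IsAlgClosed K] (hn : 1 ≤ n)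
    (D : InvertibleForm Γ.ideal l) [Module.Finite K (AffineRing Γ.ideal l)]
    (hV : IsLinearlyGeneral n (linearForms Γ.ideal l)) {k : ℕ} (hk : 3 ≤ k)
    (hd : n * k + 2 ≤ finrank K (AffineRing Γ.ideal l))
    (h : hilbertFunction Γ.ideal k = n * k + 1) : Γ.LiesOnRationalNormalCurve := by
  rw [hilbertFunction_eq D] at h
  obtain ⟨u, huV, hli, hu⟩ := hV.exists_basis_minors_eq_zero hn hk h hd
  exact liesOnRationalNormalCurve_of_minors hn D hV huV hli hu

theorem ClosedSubscheme.min_le_hilbertFunction [IsAlgClosed K] (D : InvertibleForm Γ.ideal l)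
    [Module.Finite K (AffineRing Γ.ideal l)] (hV : IsLinearlyGeneral n (linearForms Γ.ideal l))
    (k : ℕ) :
    min (finrank K (AffineRing Γ.ideal l)) (n * k + 1) ≤ hilbertFunction Γ.ideal k := by
  have h := hV.min_le_finrank_pow_sup k ⊥
  rw [Submodule.restrictScalars_bot, finrank_bot, sup_bot_eq, zero_add] at h
  rwa [hilbertFunction_eq D]

theorem ClosedSubscheme.eq_zero_of_mem_ideal (hV : IsLinearlyGeneral n (linearForms Γ.ideal l))
    {f : CoordRing K n} (hf : f ∈ Γ.ideal) (hf1 : f.IsHomogeneous 1) : f = 0 := by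
  have h1 := finrank_map_add_finrank_inf_ker (toAffine Γ.ideal l).toLinearMap
    (homogeneousSubmodule (Fin (n + 1)) K 1)
  rw [finrank_homogeneousSubmodule_one, hV.finrank_eq] at h1
  have : Module.Finite K (homogeneousSubmodule (Fin (n + 1)) K 1 ⊓
      LinearMap.ker (toAffine Γ.ideal l).toLinearMap : Submodule K (CoordRing K n)) :=
    Submodule.finiteDimensional_of_le inf_le_left
  have h3 : homogeneousSubmodule (Fin (n + 1)) K 1 ⊓
      LinearMap.ker (toAffine Γ.ideal l).toLinearMap = ⊥ :=
    Submodule.finrank_eq_zero.mp (Nat.add_eq_left.mp h1)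
  have h4 : f ∈ homogeneousSubmodule (Fin (n + 1)) K 1 ⊓
      LinearMap.ker (toAffine Γ.ideal l).toLinearMap :=
    ⟨hf1, Ideal.Quotient.eq_zero_iff_mem.mpr (Ideal.mem_sup_left hf)⟩
  rwa [h3, Submodule.mem_bot] at h4

end Main

end ProjSpace

end

theorem theorem5p3 {K : Type*} [Field K] [IsAlgClosed K] [CharZero K] {n d q r : ℕ} (hn : 2 ≤ n)
    (Γ : ProjSpace.ClosedSubscheme K n) (hfin : Γ.IsFinite)
    (hlin : Γ.IsInLinearlyGeneralPosition) (hdeg : Γ.degree = (d : ℕ∞))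
    (hd : 4 * n ^ 2 + 6 * n + 1 ≤ d) (hdq : d = n * q + r + 2) (hr : r ≤ n - 1) :
    ProjSpace.h1 Γ.ideal q ≤ ((r + 1 : ℕ) : ℕ∞) ∧
    (Γ.LiesOnRationalNormalCurve ↔ ProjSpace.h1 Γ.ideal q = ((r + 1 : ℕ) : ℕ∞)) ∧
    (∀ S : Finset (Projectivization K (Fin (n + 1) → K)),
      Γ.ideal = ProjSpace.pointsIdeal S → 0 < ProjSpace.h1 Γ.ideal q →
        (ProjSpace.IsInUniformPosition S ↔
          ProjSpace.h1 Γ.ideal q = ((r + 1 : ℕ) : ℕ∞))) := by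
  open ProjSpace in
  obtain ⟨l, ⟨D⟩⟩ := hfin.exists_invertibleForm
  have hA := ClosedSubscheme.finite_affineRing D hdeg
  have hAd := ClosedSubscheme.finrank_affineRing D hdeg
  -- If `q ≤ 4 * n + 4`, then `d ≤ n * (4 * n + 4) + (n - 1) + 2 = 4 * n ^ 2 + 5 * n + 1`, below the
  -- assumed degree.
  have hq : 4 * n + 5 ≤ q := by
    by_contra h
    have h1 : n * q ≤ n * (4 * n + 4) := Nat.mul_le_mul_left n (by omega)
    have h2 : n * (4 * n + 4) = 4 * n ^ 2 + 4 * n := by ring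
    omega
  have hV := hlin.isLinearlyGeneral D (by omega) (by omega)
  have hmin := ClosedSubscheme.min_le_hilbertFunction D hV
  rw [hAd] at hmin
  obtain ⟨m, hm, hmd⟩ : ∃ m : ℕ, ProjSpace.h1 Γ.ideal q = (m : ℕ∞) ∧
      m + hilbertFunction Γ.ideal q = d := by
    have h := ClosedSubscheme.h1_add_eq hn D hdeg q
    rw [← ClosedSubscheme.hilbertFunction_eq D] at h
    obtain ⟨m, hm⟩ := ENat.ne_top_iff_exists.mp
      (show ProjSpace.h1 Γ.ideal q ≠ ⊤ by rintro e; simp [e] at h)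
    refine ⟨m, hm.symm, ?_⟩
    rw [← hm] at h
    exact_mod_cast h
  have hminq := hmin q
  have hcurve : Γ.LiesOnRationalNormalCurve → m = r + 1 := by
    rintro ⟨C, hC, hΓC⟩
    have := hC.hilbertFunction_le hΓC q
    omega
  have hcurve' : m = r + 1 → Γ.LiesOnRationalNormalCurve := fun h =>
    ClosedSubscheme.liesOnRationalNormalCurve_of_hilbertFunction_eq (by omega) D hV
      (k := q) (by omega) (by omega) (by omega)
  rw [hm]
  simp only [Nat.cast_inj, Nat.cast_le]
  refine ⟨by omega, ⟨hcurve, hcurve'⟩, fun S hS hpos => ⟨fun hU => ?_, fun h => ?_⟩⟩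
  · have hpos' : 0 < m := by exact_mod_cast hpos
    -- In degree `d` Castelnuovo's bound already reaches `d`, and the Hilbert function of `S` never
    -- exceeds `|S|`.
    have hdS : d ≤ S.card := by
      have h1 := hmin d
      have h2 := hilbertFunction_pointsIdeal_le_card S d
      have h3 : d ≤ n * d := Nat.le_mul_of_pos_left d (by omega)
      rw [hS] at h1
      omega
    have h3 := hU.hilbertFunction_three_eq (by omega) hdS (hS ▸ hmin) hdq hr (by omega) (by omega)
      (by rw [← hS]; omega)
    have h4 : n * 3 ≤ n * q := Nat.mul_le_mul_left n (by omega)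
    -- Castelnuovo's lemma is used in degree 3 here, since the minimality of `h(q)` is what has to
    -- be proved.
    exact hcurve (ClosedSubscheme.liesOnRationalNormalCurve_of_hilbertFunction_eq (by omega) D hV
      le_rfl (by omega) (by rw [hS]; exact h3))
  · obtain ⟨C, hC, hΓC⟩ := hcurve' h
    obtain ⟨I, hI, hsat⟩ := Γ
    change I = pointsIdeal S at hS
    subst hS
    -- The upper bound from the curve meets Castelnuovo's lower bound, so the Hilbert function of a
    -- subset depends only on its size.
    have hY : ∀ Y ⊆ S, ∀ k, hilbertFunction (pointsIdeal Y) k = min Y.card (n * k + 1) := by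
      intro Y hY k
      exact le_antisymm (le_min (hilbertFunction_pointsIdeal_le_card Y k)
        (hC.hilbertFunction_le (le_trans hΓC (pointsIdeal_anti hY)) k))
        (min_card_le_hilbertFunction D hV hY k)
    refine ⟨fun f hf hf1 => ?_, fun Y hYS k => ?_⟩
    · exact ClosedSubscheme.eq_zero_of_mem_ideal hV hf hf1
    · have := Finset.card_le_card hYS
      rw [hY Y hYS, hY S subset_rfl]
      omega
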